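/- Let $n\ge 1$ and let $\mathfrak g=\bigoplus_{j\in\mathbb Z/n}\mathfrak g_j$ be a finite-dimensional simple complex Lie algebra with a $\mathbb Z/n$-grading ($[\mathfrak g_i,\mathfrak g_j]\subseteq\mathfrak g_{i+j}$). Put $\mathfrak g_+=\bigoplus_{j\ne 0}\mathfrak g_j$. Let $\mathfrak h_0$ be a Cartan subalgebra of the reductive Lie algebra $\mathfrak g_0$, let $\mathfrak b_0\supseteq\mathfrak h_0$ be a Borel subalgebra of $\mathfrak g_0$, let $\Delta_0\subset\mathfrak h_0^*$ be the set of simple roots of $\mathfrak g_0$ determined by $\mathfrak b_0$, and let $Q_0^+$ be the set of linear combinations of elements of $\Delta_0$ with nonnegative integer coefficients. Add pairs in $\mathfrak h_0^*\times\mathbb Z/n$ componentwise, and write $(\mu,i)\preccurlyeq_0(\nu,j)$ if $i=j$ and $\nu-\mu\in Q_0^+$. Let $$\Sigma_+=\{(\mu,j) : j\neq 0,\ \mu\ne 0,\ \mu \text{ is an } \mathfrak h_0\text{-weight of } \mathfrak g_j\}.$$ An abelian positively-graded $\mathfrak b_0$-module subalgebra is a Lie subalgebra $\mathfrak i\subseteq\mathfrak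 g_+$ with $[\mathfrak i,\mathfrak i]=0$, $[\mathfrak b_0,\mathfrak i]\subseteq\mathfrak i$ and $\mathfrak i=\bigoplus_{j\neq0}(\mathfrak i\cap\mathfrak g_j)$. Let $\mathcal A_{\mathfrak i}$ be the set of $\preccurlyeq_0$-minimal elements of the set of pairs $(\mu,j)$ such that $\mu$ is an $\mathfrak h_0$-weight of $\mathfrak i\cap\mathfrak g_j$. A set $\mathcal A$ of pairs generates such a subalgebra if $\mathcal A=\mathcal A_{\mathfrak i}$ for some abelian positively-graded $\mathfrak b_0$-module subalgebra $\mathfrak i$. Let $\mathcal A\subseteq\Sigma_+$ be an antichain for $\preccurlyeq_0$. Then $\mathcal A$ generates an abelian positively-graded $\mathfrak b_0$-module subalgebra if and only if, for all $(\mu_1,j_1),(\mu_2,j_2)\in\mathcal A$ (not necessarily distinct) and every highest weight $\lambda$ of the $\mathfrak g_0$-module $\mathfrak g_{j_1+j_2}$ (the weight of a nonzero $\mathfrak h_0$-weight vector annihilated by all positive root vectors of $\mathfrak g_0$), $$(\mu_1,j_1)+(\mu_2,j_2)\not\preccurlyeq_0(\lambda,j_1+j_2).$$ -/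

import Mathlib

noncomputable section

namespace GradedBorel

variable {n : ℕ} {L : Type*} [LieRing L] [LieAlgebra ℂ L]

/-- The degree zero part `𝔤₀` of a `ℤ/n`-graded Lie algebra, as a Lie subalgebra. -/
def degreeZero (𝔤 : ZMod n → Submodule ℂ L) [SetLike.GradedBracket 𝔤] : LieSubalgebra ℂ L where
  __ := 𝔤 0
  lie_mem' := fun {x y} hx hy => by
    have h := SetLike.GradedBracket.bracket_mem (ℒ := 𝔤) hx hy
    rw [add_zero] at h
    exact h

/-- The sum `𝔤₊` of the homogeneous components of nonzero degree. -/
def positivePart (𝔤 : ZMod n → Submodule ℂ L) : Submodule ℂ L :=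
  ⨆ (j : ZMod n) (_ : j ≠ 0), 𝔤 j

/-- A Borel subalgebra of a Lie algebra: a maximal solvable subalgebra. -/
def IsBorel {M : Type*} [LieRing M] [LieAlgebra ℂ M] (b : LieSubalgebra ℂ M) : Prop :=
  Maximal (fun s : LieSubalgebra ℂ M => LieAlgebra.IsSolvable s) b

variable (𝔤 : ZMod n → Submodule ℂ L) [SetLike.GradedBracket 𝔤]

/-- Pairs `(μ, j)` of a linear form on `𝔥₀` and a degree, with componentwise addition. -/
abbrev GradedWeight (h₀ : LieSubalgebra ℂ (degreeZero 𝔤)) : Type _ :=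
  Module.Dual ℂ h₀ × ZMod n

variable (h₀ b₀ : LieSubalgebra ℂ (degreeZero 𝔤))

/-- The `𝔥₀`-weight space `{x ∈ 𝔤_j | ⁅h, x⁆ = μ(h) x for all h ∈ 𝔥₀}`, for a pair `(μ, j)`. -/
def weightComponent (p : GradedWeight 𝔤 h₀) : Submodule ℂ L :=
  𝔤 p.2 ⊓ (LieModule.weightSpace L (p.1 : h₀ → ℂ)).toSubmodule

/-- `Σ₊`: the pairs `(μ, j)` with `j ≠ 0` and `μ` a nonzero `𝔥₀`-weight of `𝔤_j`. -/
def sigmaPlus : Set (GradedWeight 𝔤 h₀) :=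
  {p | weightComponent 𝔤 h₀ p ≠ ⊥ ∧ p.1 ≠ 0 ∧ p.2 ≠ 0}

/-- The positive roots of `𝔤₀` determined by `𝔟₀`: the nonzero `𝔥₀`-weights of `𝔟₀`. -/
def positiveRoots : Set (Module.Dual ℂ h₀) :=
  {α | α ≠ 0 ∧ ∃ e ∈ b₀, e ≠ 0 ∧ (e : L) ∈ weightComponent 𝔤 h₀ (α, 0)}

/-- The simple roots `Δ₀`: the positive roots that are not a sum of two positive roots. -/
def simpleRoots : Set (Module.Dual ℂ h₀) :=
  {α | α ∈ positiveRoots 𝔤 h₀ b₀ ∧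
    ∀ β ∈ positiveRoots 𝔤 h₀ b₀, ∀ γ ∈ positiveRoots 𝔤 h₀ b₀, β + γ ≠ α}

/-- `Q₀⁺`: the linear combinations of simple roots with nonnegative integer coefficients. -/
def positiveCone : AddSubmonoid (Module.Dual ℂ h₀) :=
  AddSubmonoid.closure (simpleRoots 𝔤 h₀ b₀)

/-- The order `≼₀`. It is defined here on all of `𝔥₀* × ℤ/n`; on pairs with integral first
component it is the usual order, and all weights of `𝔤` are integral. -/
def WeightLE (p q : GradedWeight 𝔤 h₀) : Prop :=
  p.2 = q.2 ∧ q.1 - p.1 ∈ positiveCone 𝔤 h₀ b₀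

/-- `λ` is a highest weight of the `𝔤₀`-module `𝔤_j`: there is a nonzero vector of weight `λ` in
`𝔤_j` annihilated by all positive root vectors of `𝔤₀`. -/
def IsHighestWeight (lam : Module.Dual ℂ h₀) (j : ZMod n) : Prop :=
  ∃ v ∈ weightComponent 𝔤 h₀ (lam, j), v ≠ 0 ∧
    ∀ α ∈ positiveRoots 𝔤 h₀ b₀, ∀ e ∈ weightComponent 𝔤 h₀ (α, 0), ⁅e, v⁆ = 0

/-- `k`-nilpotent positively-graded `𝔟₀`-module subalgebras of `𝔤₊`. The term
`lowerCentralSeries ℂ i i k` is `(ad i)^k (i)`. -/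
structure IsNilpotentModuleSubalgebra (k : ℕ) (i : LieSubalgebra ℂ L) : Prop where
  le_positivePart : i.toSubmodule ≤ positivePart 𝔤
  borel_stable : ∀ b ∈ b₀, ∀ x ∈ i, ⁅(b : L), x⁆ ∈ i
  nilpotent : LieModule.lowerCentralSeries ℂ i i k = ⊥
  graded : i.toSubmodule = ⨆ (j : ZMod n) (_ : j ≠ 0), i.toSubmodule ⊓ 𝔤 j

/-- Abelian positively-graded `𝔟₀`-module subalgebras: the case `k = 1`. -/
def IsAbelianModuleSubalgebra (i : LieSubalgebra ℂ L) : Prop :=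
  IsNilpotentModuleSubalgebra 𝔤 b₀ 1 i

/-- The set of graded `𝔥₀`-weights of `i`: the pairs `(μ, j)` with `μ` a weight of `i ∩ 𝔤_j`. -/
def gradedWeights (i : LieSubalgebra ℂ L) : Set (GradedWeight 𝔤 h₀) :=
  {p | i.toSubmodule ⊓ weightComponent 𝔤 h₀ p ≠ ⊥}

/-- `𝒜_i`: the graded weights of `i` that are minimal for `≼₀`. -/
def minimalWeights (i : LieSubalgebra ℂ L) : Set (GradedWeight 𝔤 h₀) :=
  {p | p ∈ gradedWeights 𝔤 h₀ i ∧
    ∀ q ∈ gradedWeights 𝔤 h₀ i, WeightLE 𝔤 h₀ b₀ q p → q = p}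

/-- `A` generates an abelian positively-graded `𝔟₀`-module subalgebra. -/
def GeneratesAbelian (A : Set (GradedWeight 𝔤 h₀)) : Prop :=
  ∃ i : LieSubalgebra ℂ L,
    IsAbelianModuleSubalgebra 𝔤 b₀ i ∧ A = minimalWeights 𝔤 h₀ b₀ i

end GradedBorel

end

/-!
The approach is that of the affine root system of the grading. The pairs `(μ, j)` with `μ` a weight
of `𝔤_j` grade `𝔤` by the group `𝔥₀* × ℤ/n`, the component of degree zero is `𝔥₀`
(`mem_weightComponent_zero`), and `𝔥₀` acts diagonalizably, because the semisimple part of `ad h` is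
an inner derivation (`lie_eq_smul_of_mem_genWeightSpace`). The Killing form pairs opposite
components. Hence the pairs with `μ ≠ 0`, the real roots, behave like the roots of a semisimple Lie
algebra: each belongs to an `𝔰𝔩₂`-triple (`exists_isSl2Triple`), the form on `𝔥₀*` is positive on
it (`weightForm_self_pos`), its root space is a line (`exists_eq_smul`), and two real root
spaces whose sum is a weight have a nonzero bracket (`lie_ne_zero_of_weightComponent_add_ne_bot`).

Suppose that `i` is an abelian module subalgebra with minimal weights `γ` and `δ`, and that
`λ = γ + δ + s` is a weight with `s` a sum of simple roots
(`weightComponent_add_sum_eq_bot`). As long as a summand `α` of `s` satisfies `(γ, α) < 0` or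
`(δ, α) < 0`, one may move `γ` or `δ` up by `α` within `i`; this never reaches the weight zero,
because `i` contains no weight `-α` with `α` a positive root. Once this is no longer possible, all
products between `γ`, `δ` and `s` are nonnegative, the product of `γ` and `δ` being so because `i`
is abelian. Then `(λ, γ) > 0`, so `δ + s` is a weight, and `(δ + s, δ) > 0`, so `s`
is zero or a root of `𝔤₀`. In the second case it is a positive root, and `γ` can be moved up by `s`.
So one ends with `s = 0`, where `γ + δ` is a weight and the bracket of the root spaces is not zero.

Conversely, the weight spaces that lie above elements of `A` span a subspace that is stable under
`𝔟₀`. If it had a nonzero bracket, then the weight of that bracket would lie below a highest weight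
(`exists_isHighestWeight`), and so would the sum of two elements of `A`. That `A` is its set of
minimal weights uses that `≼₀` is antisymmetric, that is, that no nonempty sum of positive roots
vanishes (`sum_ne_zero_of_positiveRoots`); this rests on the solvability of `𝔟₀`.
-/

noncomputable section

namespace GradedBorel

open LieAlgebra LieModule Module
open scoped DirectSum

/-! ### Algebras graded by an abelian group -/

section AbstractGrading

variable {G : Type*} [AddCommGroup G] {M : Type*} [LieRing M] [LieAlgebra ℂ M]

/-- Refining one independent family of submodules by another one gives an independent family. -/
lemma iSupIndep_inf {R N ι κ : Type*} [Ring R] [AddCommGroup N] [Module R N]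
    {A : ι → Submodule R N} {B : κ → Submodule R N} (hA : iSupIndep A) (hB : iSupIndep B) :
    iSupIndep fun p : ι × κ => A p.1 ⊓ B p.2 := by
  rintro ⟨i, k⟩
  rw [Submodule.disjoint_def]
  rintro x ⟨hxA, hxB⟩ hx
  have hle : (⨆ (q : ι × κ) (_ : q ≠ (i, k)), A q.1 ⊓ B q.2) ≤
      (⨆ (i' : ι) (_ : i' ≠ i), A i') ⊔ (⨆ (k' : κ) (_ : k' ≠ k), A i ⊓ B k') := by
    refine iSup₂_le ?_
    rintro ⟨i', k'⟩ hne
    by_cases hi : i' = i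
    · subst hi
      have hk : k' ≠ k := fun h => hne (by rw [h])
      exact le_sup_of_le_right (le_iSup₂_of_le k' hk le_rfl)
    · exact le_sup_of_le_left (le_iSup₂_of_le i' hi inf_le_left)
  obtain ⟨a, ha, b, hb, rfl⟩ := Submodule.mem_sup.mp (hle hx)
  have hbA : b ∈ A i := (iSup₂_le fun _ _ => inf_le_left :
    (⨆ (k' : κ) (_ : k' ≠ k), A i ⊓ B k') ≤ A i) hb
  have hbB : b ∈ ⨆ (k' : κ) (_ : k' ≠ k), B k' :=
    (iSup₂_mono fun _ _ => inf_le_right :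
      (⨆ (k' : κ) (_ : k' ≠ k), A i ⊓ B k') ≤ ⨆ (k' : κ) (_ : k' ≠ k), B k') hb
  have ha0 : a = 0 := by
    refine (Submodule.disjoint_def.mp (hA i)) a ?_ ha
    simpa using (A i).sub_mem hxA hbA
  subst ha0
  rw [zero_add] at hxB ⊢
  exact (Submodule.disjoint_def.mp (hB k)) b hxB hbB

/-- Homogeneous components whose degrees do not add up to zero are orthogonal for the Killing
form. -/
lemma killingForm_eq_zero_of_add_ne_zero [FiniteDimensional ℂ M] {W : G → Submodule ℂ M}
    (hind : iSupIndep W) (htop : ⨆ p, W p = ⊤)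
    (hlie : ∀ p q x y, x ∈ W p → y ∈ W q → ⁅x, y⁆ ∈ W (p + q)) {p q : G} {x y : M}
    (hx : x ∈ W p) (hy : y ∈ W q) (hpq : p + q ≠ 0) : killingForm ℂ M x y = 0 := by
  classical
  have hint := DirectSum.isInternal_submodule_of_iSupIndep_of_iSup_eq_top hind htop
  rw [killingForm_apply_apply]
  refine LinearMap.trace_eq_zero_of_mapsTo_ne hint (fun r => p + (q + r)) (fun r => ?_)
    fun r z hz => hlie _ _ _ _ hx (hlie _ _ _ _ hy hz)
  simpa only [← add_assoc] using add_ne_right.mpr hpq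

/-- An element that acts on each homogeneous component by a scalar has degree zero if the
center is trivial. -/
lemma mem_zero_of_lie_eq_smul {W : G → Submodule ℂ M}
    (hind : iSupIndep W) (htop : ⨆ p, W p = ⊤)
    (hlie : ∀ p q x y, x ∈ W p → y ∈ W q → ⁅x, y⁆ ∈ W (p + q))
    (hcenter : ∀ z : M, (∀ w : M, ⁅z, w⁆ = 0) → z = 0) {y : M}
    (hy : ∀ q, ∀ z ∈ W q, ⁅y, z⁆ ∈ W q) : y ∈ W 0 := by
  have hyt : y ∈ W 0 ⊔ ⨆ (p : G) (_ : p ≠ 0), W p := by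
    rw [← iSup_split_single W 0, htop]
    trivial
  obtain ⟨a, ha, b, hb, rfl⟩ := Submodule.mem_sup.mp hyt
  suffices b = 0 by simpa [this] using ha
  have key : ∀ q, ∀ z ∈ W q, ⁅b, z⁆ = 0 := by
    intro q z hz
    have hbz : ⁅b, z⁆ ∈ W q := by
      have h1 := hy q z hz
      have h2 := hlie _ _ _ _ ha hz
      rw [zero_add] at h2
      simpa [add_lie] using (W q).sub_mem h1 h2
    clear hy hyt
    refine Submodule.disjoint_def.mp (hind q) _ hbz ?_
    clear hbz
    induction hb using Submodule.iSup_induction' with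
    | mem p u hu =>
      by_cases hp : p = 0
      · have : u = 0 := by simpa [hp] using hu
        simp [this]
      · have hu' : u ∈ W p := by simpa [hp] using hu
        exact Submodule.mem_iSup_of_mem (p + q)
          (Submodule.mem_iSup_of_mem (by simpa using hp) (hlie _ _ _ _ hu' hz))
    | zero => simp
    | add u v _ _ hu hv => rw [add_lie]; exact Submodule.add_mem _ hu hv
  refine hcenter b fun w => ?_
  have hw : w ∈ ⨆ p, W p := htop ▸ Submodule.mem_top
  induction hw using Submodule.iSup_induction' with
  | mem q z hz => exact key q z hz
  | zero => simp
  | add u v _ _ hu hv => rw [lie_add, hu, hv, add_zero]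

end AbstractGrading

/-! ### The weight decomposition -/

section WeightDecomposition

variable {n : ℕ} {L : Type*} [LieRing L] [LieAlgebra ℂ L]
variable (𝔤 : ZMod n → Submodule ℂ L)

lemma eq_zero_of_forall_lie_eq_zero [FiniteDimensional ℂ L] [IsKilling ℂ L] {z : L}
    (hz : ∀ w : L, ⁅z, w⁆ = 0) : z = 0 := by
  have : z ∈ LieAlgebra.center ℂ L := by
    rw [LieModule.mem_maxTrivSubmodule]
    intro w
    rw [← lie_skew, hz, neg_zero]
  simpa using this

variable [GradedLieAlgebra 𝔤] (h₀ : LieSubalgebra ℂ (degreeZero 𝔤))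

/-- The component `𝔤_j`, as a module over a subalgebra of `𝔤₀`. -/
def componentSubmodule (j : ZMod n) : LieSubmodule ℂ h₀ L where
  __ := 𝔤 j
  lie_mem := fun {h x} hx => by
    have := SetLike.GradedBracket.bracket_mem (ℒ := 𝔤) (i := 0) (gi := ((h : degreeZero 𝔤) : L))
      h.1.2 hx
    rwa [zero_add] at this

/-- The generalized `𝔥₀`-weight space in degree `j`, for an arbitrary function `χ` on `𝔥₀`. -/
def genComponent [LieRing.IsNilpotent h₀] (p : (h₀ → ℂ) × ZMod n) : Submodule ℂ L :=
  (genWeightSpace L p.1).toSubmodule ⊓ 𝔤 p.2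

section Nilpotent

variable [LieRing.IsNilpotent h₀]

lemma lie_mem_genWeightSpace {χ ψ : h₀ → ℂ} {x y : L} (hx : x ∈ genWeightSpace L χ)
    (hy : y ∈ genWeightSpace L ψ) : ⁅x, y⁆ ∈ genWeightSpace L (χ + ψ) := by
  rw [genWeightSpace, LieSubmodule.mem_iInf] at hx hy ⊢
  intro h
  exact LieModule.lie_mem_maxGenEigenspace_toEnd (R := ℂ) (L := L) (M := L)
    (x := ((h : degreeZero 𝔤) : L)) (hx h) (hy h)

lemma lie_mem_genComponent (p q : (h₀ → ℂ) × ZMod n) (x y : L) (hx : x ∈ genComponent 𝔤 h₀ p)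
    (hy : y ∈ genComponent 𝔤 h₀ q) : ⁅x, y⁆ ∈ genComponent 𝔤 h₀ (p + q) :=
  ⟨lie_mem_genWeightSpace 𝔤 h₀ hx.1 hy.1, SetLike.GradedBracket.bracket_mem hx.2 hy.2⟩

lemma iSupIndep_genComponent : iSupIndep (genComponent 𝔤 h₀) :=
  iSupIndep_inf (LieSubmodule.iSupIndep_toSubmodule.mpr (iSupIndep_genWeightSpace ℂ h₀ L))
    (DirectSum.Decomposition.isInternal 𝔤).submodule_iSupIndep

variable [FiniteDimensional ℂ L]

lemma iSup_genComponent : ⨆ p, genComponent 𝔤 h₀ p = ⊤ := by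
  rw [eq_top_iff, ← (DirectSum.Decomposition.isInternal 𝔤).submodule_iSup_eq_top]
  refine iSup_le fun j => ?_
  have h := congrArg LieSubmodule.toSubmodule
    (eq_iSup_inf_genWeightSpace ℂ h₀ L (componentSubmodule 𝔤 h₀ j))
  rw [LieSubmodule.iSup_toSubmodule] at h
  change 𝔤 j = _ at h
  rw [h]
  refine iSup_le fun χ => ?_
  exact le_trans (le_of_eq (inf_comm (𝔤 j) _)) (le_iSup (genComponent 𝔤 h₀) (χ, j))

/-- Every weight of `𝔥₀` on `𝔤` occurs in some degree. -/
lemma exists_genComponent_ne_bot (χ : Weight ℂ h₀ L) : ∃ j, genComponent 𝔤 h₀ (χ, j) ≠ ⊥ := by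
  by_contra! hbot
  have hind := LieSubmodule.iSupIndep_toSubmodule.mpr (iSupIndep_genWeightSpace ℂ h₀ L) χ
  have htop : (⊤ : Submodule ℂ L) ≤
      ⨆ (ψ : h₀ → ℂ) (_ : ψ ≠ χ), (genWeightSpace L ψ).toSubmodule := by
    rw [← iSup_genComponent 𝔤 h₀]
    refine iSup_le fun p => ?_
    by_cases hp : p.1 = χ
    · have : genComponent 𝔤 h₀ p = ⊥ := by rw [← hbot p.2, ← hp]
      rw [this]
      exact bot_le
    · exact le_iSup₂_of_le p.1 hp inf_le_left
  obtain ⟨x, hx, hx0⟩ := χ.exists_ne_zero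
  exact hx0 (Submodule.disjoint_def.mp hind x hx (htop Submodule.mem_top))

end Nilpotent

variable [FiniteDimensional ℂ L] [h₀.IsCartanSubalgebra]

lemma mem_genComponent_zero {x : L} :
    x ∈ genComponent 𝔤 h₀ 0 ↔ ∃ h : h₀, ((h : degreeZero 𝔤) : L) = x := by
  have hpow (g : h₀) (y : degreeZero 𝔤) (k : ℕ) :
      (((toEnd ℂ h₀ (degreeZero 𝔤) g) ^ k) y : L) = ((toEnd ℂ h₀ L g) ^ k) (y : L) := by
    induction k with
    | zero => rfl
    | succ m ih =>
      rw [pow_succ', pow_succ', Module.End.mul_apply, Module.End.mul_apply, ← ih]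
      rfl
  have hiff (y : degreeZero 𝔤) :
      (y : L) ∈ genWeightSpace L (0 : h₀ → ℂ) ↔ y ∈ rootSpace h₀ (0 : h₀ → ℂ) := by
    rw [mem_genWeightSpace, mem_genWeightSpace]
    refine forall_congr' fun g => exists_congr fun k => ?_
    rw [Pi.zero_apply, zero_smul, zero_smul, sub_zero, sub_zero, ← hpow, ZeroMemClass.coe_eq_zero]
  constructor
  · rintro ⟨hx, hx0⟩
    have := (hiff ⟨x, hx0⟩).mp hx
    rw [rootSpace_zero_eq, LieSubalgebra.mem_toLieSubmodule] at this
    exact ⟨⟨_, this⟩, rfl⟩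
  · rintro ⟨h, rfl⟩
    refine ⟨(hiff h).mpr ?_, h.1.2⟩
    rw [rootSpace_zero_eq, LieSubalgebra.mem_toLieSubmodule]
    exact h.2

lemma killingForm_eq_sum (x y : h₀) :
    killingForm ℂ L ((x : degreeZero 𝔤) : L) ((y : degreeZero 𝔤) : L) =
      ∑ χ : Weight ℂ h₀ L, finrank ℂ (genWeightSpace L χ) • (χ x * χ y) :=
  traceForm_eq_sum_finrank_nsmul_mul ℂ h₀ L x y

lemma iSup_weight_inf (N : LieSubmodule ℂ h₀ L) :
    N.toSubmodule = ⨆ χ : Weight ℂ h₀ L, N.toSubmodule ⊓ (genWeightSpace L χ).toSubmodule := by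
  have h := congrArg LieSubmodule.toSubmodule (eq_iSup_inf_genWeightSpace ℂ h₀ L N)
  rwa [LieSubmodule.iSup_toSubmodule] at h

variable [IsKilling ℂ L]

/-- The Killing form pairs the components of opposite degree of a grading nondegenerately. -/
lemma eq_zero_of_killingForm_eq_zero {G : Type*} [AddCommGroup G] {W : G → Submodule ℂ L}
    (hind : iSupIndep W) (htop : ⨆ p, W p = ⊤)
    (hlie : ∀ p q x y, x ∈ W p → y ∈ W q → ⁅x, y⁆ ∈ W (p + q)) {p : G} {x : L} (hx : x ∈ W p)
    (h : ∀ y ∈ W (-p), killingForm ℂ L x y = 0) : x = 0 := by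
  have : x ∈ LinearMap.ker (killingForm ℂ L) := by
    rw [LinearMap.mem_ker]
    ext w
    have hw : w ∈ ⨆ p, W p := htop ▸ Submodule.mem_top
    induction hw using Submodule.iSup_induction' with
    | mem q z hz =>
      by_cases hq : p + q = 0
      · rw [add_eq_zero_iff_neg_eq] at hq
        exact h z (hq ▸ hz)
      · exact killingForm_eq_zero_of_add_ne_zero hind htop hlie hx hz hq
    | zero => simp
    | add u v _ _ hu hv => rw [map_add, hu, hv]; simp
  simpa using this

/-- Since the trace form of `𝔥₀` is determined by the weights, no nonzero element of `𝔥₀` is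
annihilated by all of them. -/
lemma eq_zero_of_forall_weight_eq_zero {h : h₀} (hh : ∀ χ : Weight ℂ h₀ L, χ h = 0) : h = 0 := by
  have : ((h : degreeZero 𝔤) : L) = 0 := by
    refine eq_zero_of_killingForm_eq_zero (iSupIndep_genComponent 𝔤 h₀)
      (iSup_genComponent 𝔤 h₀) (lie_mem_genComponent 𝔤 h₀) (p := 0)
      ((mem_genComponent_zero 𝔤 h₀).mpr ⟨h, rfl⟩) fun y hy => ?_
    rw [neg_zero] at hy
    obtain ⟨g, rfl⟩ := (mem_genComponent_zero 𝔤 h₀).mp hy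
    rw [killingForm_eq_sum]
    simp [hh]
  exact Subtype.ext (Subtype.ext this)

open Module.End in
/-- `𝔥₀` acts diagonalizably on `𝔤`. The semisimple part of `ad h` is a derivation, hence inner;
it is given by an element that commutes with `𝔥₀` and has degree zero, that is, by an element of
`𝔥₀`, and no nonzero element of `𝔥₀` has only zero weights. -/
lemma lie_eq_smul_of_mem_genWeightSpace (h : h₀) {χ : h₀ → ℂ} {x : L}
    (hx : x ∈ genWeightSpace L χ) : ⁅h, x⁆ = χ h • x := by
  obtain ⟨N, -, S, hS₀, hN, hS, hSN⟩ := (toEnd ℂ h₀ L h).exists_isNilpotent_isSemisimple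
  replace hS₀ : Commute (toEnd ℂ h₀ L h) S := Algebra.commute_of_mem_adjoin_self hS₀
  have hN' := hN
  rw [eq_sub_of_add_eq hSN.symm] at hN
  have aux {α : h₀ → ℂ} {y : L} (hy : y ∈ genWeightSpace L α) : S y = α h • y := by
    replace hy : y ∈ (toEnd ℂ h₀ L h).maxGenEigenspace (α h) :=
      (genWeightSpace_le_genWeightSpaceOf L h α) hy
    rw [maxGenEigenspace_eq] at hy
    set k := maxGenEigenspaceIndex (toEnd ℂ h₀ L h) (α h)
    rw [apply_eq_of_mem_of_comm_of_isFinitelySemisimple_of_isNil hy hS₀ hS.isFinitelySemisimple hN]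
  have h_der (y z : L) : S ⁅y, z⁆ = ⁅S y, z⁆ + ⁅y, S z⁆ := by
    have hy : y ∈ ⨆ α : h₀ → ℂ, genWeightSpace L α := by simp [iSup_genWeightSpace_eq_top]
    have hz : z ∈ ⨆ α : h₀ → ℂ, genWeightSpace L α := by simp [iSup_genWeightSpace_eq_top]
    induction hy using LieSubmodule.iSup_induction' with
    | mem α y hy =>
      induction hz using LieSubmodule.iSup_induction' with
      | mem β z hz =>
        rw [aux hy, aux hz, aux (lie_mem_genWeightSpace 𝔤 h₀ hy hz), smul_lie, lie_smul,
          ← add_smul, ← Pi.add_apply]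
      | zero => simp
      | add _ _ _ _ h h' => simp only [lie_add, map_add, h, h']; abel
    | zero => simp
    | add _ _ _ _ h h' => simp only [add_lie, map_add, h, h']; abel
  replace h_der : ∀ y z : L, S ⁅y, z⁆ = ⁅y, S z⁆ - ⁅z, S y⁆ := by
    simp_rw [← lie_skew (S _) _, add_comm, ← sub_eq_add_neg] at h_der; assumption
  let S' : LieDerivation ℂ L L := ⟨S, h_der⟩
  obtain ⟨y, hy⟩ := LieDerivation.IsKilling.exists_eq_ad S'
  have hyS (z : L) : ⁅y, z⁆ = S z := by
    rw [← LieDerivation.ad_apply_apply (R := ℂ), hy]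
    rfl
  have hy0 : y ∈ genComponent 𝔤 h₀ 0 := by
    refine mem_zero_of_lie_eq_smul (iSupIndep_genComponent 𝔤 h₀)
      (iSup_genComponent 𝔤 h₀) (lie_mem_genComponent 𝔤 h₀)
      (fun z hz => eq_zero_of_forall_lie_eq_zero hz) fun q z hz => ?_
    rw [hyS, aux hz.1]
    exact Submodule.smul_mem _ _ hz
  obtain ⟨g, rfl⟩ := (mem_genComponent_zero 𝔤 h₀).mp hy0
  have hgh : h - g = 0 := by
    refine eq_zero_of_forall_weight_eq_zero 𝔤 h₀ fun ψ => ?_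
    refine Weight.apply_eq_zero_of_isNilpotent (R := ℂ) (M := L) (h - g) ?_ ψ
    have : toEnd ℂ h₀ L (h - g) = N := by
      ext z
      rw [map_sub, LinearMap.sub_apply, hSN, LinearMap.add_apply]
      have : toEnd ℂ h₀ L g z = S z := hyS z
      rw [this, add_sub_cancel_right]
    rwa [this]
  rw [sub_eq_zero] at hgh
  subst hgh
  rw [← aux hx]
  exact hyS x

lemma genWeightSpace_eq_weightSpace (χ : h₀ → ℂ) : genWeightSpace L χ = weightSpace L χ :=
  le_antisymm (fun x hx => (mem_weightSpace χ x).mpr fun h =>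
    lie_eq_smul_of_mem_genWeightSpace 𝔤 h₀ h hx) (weightSpace_le_genWeightSpace L χ)

lemma weightComponent_eq_genComponent (p : GradedWeight 𝔤 h₀) :
    weightComponent 𝔤 h₀ p = genComponent 𝔤 h₀ (p.1, p.2) := by
  rw [weightComponent, genComponent, inf_comm, genWeightSpace_eq_weightSpace 𝔤 h₀]

lemma iSupIndep_weightComponent : iSupIndep (weightComponent 𝔤 h₀) := by
  have h := (iSupIndep_genComponent 𝔤 h₀).comp
    (f := fun p : GradedWeight 𝔤 h₀ => ((p.1 : h₀ → ℂ), p.2)) (fun p q hpq => by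
      rw [Prod.mk.injEq] at hpq
      exact Prod.ext (DFunLike.coe_injective hpq.1) hpq.2)
  convert h using 1
  funext p
  exact weightComponent_eq_genComponent 𝔤 h₀ p

lemma le_iSup_weightComponent (j : ZMod n) (N : LieSubmodule ℂ h₀ L) (hN : N.toSubmodule ≤ 𝔤 j) :
    N.toSubmodule ≤ ⨆ μ : Dual ℂ h₀, N.toSubmodule ⊓ weightComponent 𝔤 h₀ (μ, j) := by
  conv_lhs => rw [iSup_weight_inf 𝔤 h₀ N]
  refine iSup_le fun χ => le_iSup_of_le χ.toLinear (le_inf inf_le_left ?_)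
  rw [weightComponent_eq_genComponent]
  exact le_inf inf_le_right (inf_le_left.trans hN)

lemma iSup_weightComponent : ⨆ p, weightComponent 𝔤 h₀ p = ⊤ := by
  rw [eq_top_iff, ← (DirectSum.Decomposition.isInternal 𝔤).submodule_iSup_eq_top]
  refine iSup_le fun j => ?_
  exact (le_iSup_weightComponent 𝔤 h₀ j (componentSubmodule 𝔤 h₀ j) le_rfl).trans
    (iSup_le fun μ => inf_le_right.trans (le_iSup (weightComponent 𝔤 h₀) (μ, j)))

end WeightDecomposition

/-! ### The Killing form and the roots of the graded algebra -/

section Roots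

variable {n : ℕ} {L : Type*} [LieRing L] [LieAlgebra ℂ L]

/-- A commutator `t = ⁅x, y⁆` that commutes with `x` and `y` has zero as its only eigenvalue: its
trace on an eigenspace vanishes, since `x` and `y` preserve the eigenspace. -/
lemma eq_zero_of_lie_lie_eq_zero [FiniteDimensional ℂ L] {x y t z : L} {c : ℂ} (hxy : ⁅x, y⁆ = t) (hx : ⁅t, x⁆ = 0)
    (hy : ⁅t, y⁆ = 0) (hz : z ≠ 0) (hc : ⁅t, z⁆ = c • z) : c = 0 := by
  let E := (ad ℂ L t).eigenspace c
  have hmaps {u : L} (hu : ⁅t, u⁆ = 0) : ∀ v ∈ E, ad ℂ L u v ∈ E := by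
    intro v hv
    rw [Module.End.mem_eigenspace_iff, ad_apply] at hv ⊢
    rw [ad_apply, leibniz_lie, hu, zero_lie, zero_add, hv, lie_smul]
  let X := (ad ℂ L x).restrict (hmaps hx)
  let Y := (ad ℂ L y).restrict (hmaps hy)
  have hXY : X * Y - Y * X = c • 1 := by
    ext v
    have hv := v.2
    rw [Module.End.mem_eigenspace_iff, ad_apply] at hv
    change ⁅x, ⁅y, (v : L)⁆⁆ - ⁅y, ⁅x, (v : L)⁆⁆ = c • (v : L)
    rw [← hv, ← hxy, lie_lie]
  have htr := congrArg (LinearMap.trace ℂ E) hXY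
  rw [map_sub, LinearMap.trace_mul_comm, sub_self, map_smul, LinearMap.trace_one, smul_eq_mul,
    eq_comm, mul_eq_zero] at htr
  refine htr.resolve_right fun h => hz ?_
  rw [Nat.cast_eq_zero, Submodule.finrank_eq_zero] at h
  have : z ∈ E := Module.End.mem_eigenspace_iff.mpr hc
  rwa [h, Submodule.mem_bot] at this

variable {𝔤 : ZMod n → Submodule ℂ L} [GradedLieAlgebra 𝔤] {h₀ : LieSubalgebra ℂ (degreeZero 𝔤)}

lemma lie_eq_smul_of_mem_weightComponent (h : h₀) {p : GradedWeight 𝔤 h₀} {x : L}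
    (hx : x ∈ weightComponent 𝔤 h₀ p) : ⁅((h : degreeZero 𝔤) : L), x⁆ = p.1 h • x :=
  (mem_weightSpace _ x).mp hx.2 h

lemma lie_mem_weightComponent {p q : GradedWeight 𝔤 h₀} {x y : L}
    (hx : x ∈ weightComponent 𝔤 h₀ p) (hy : y ∈ weightComponent 𝔤 h₀ q) :
    ⁅x, y⁆ ∈ weightComponent 𝔤 h₀ (p + q) := by
  refine ⟨SetLike.GradedBracket.bracket_mem hx.1 hy.1, (mem_weightSpace _ _).mpr fun h => ?_⟩
  change ⁅((h : degreeZero 𝔤) : L), ⁅x, y⁆⁆ = (p.1 + q.1) h • ⁅x, y⁆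
  rw [leibniz_lie, lie_eq_smul_of_mem_weightComponent h hx,
    lie_eq_smul_of_mem_weightComponent h hy, smul_lie, lie_smul, ← add_smul,
    LinearMap.add_apply]

lemma pow_ad_mem {p q : GradedWeight 𝔤 h₀} {x v : L} (hx : x ∈ weightComponent 𝔤 h₀ p)
    (hv : v ∈ weightComponent 𝔤 h₀ q) (k : ℕ) :
    ((toEnd ℂ L L x) ^ k) v ∈ weightComponent 𝔤 h₀ (q + k • p) := by
  induction k with
  | zero => simpa using hv
  | succ k ih =>
    rw [pow_succ', Module.End.mul_apply, toEnd_apply_apply, succ_nsmul', add_left_comm]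
    exact lie_mem_weightComponent hx ih

variable [FiniteDimensional ℂ L] [IsKilling ℂ L] [h₀.IsCartanSubalgebra]

lemma mem_weightComponent_zero {x : L} :
    x ∈ weightComponent 𝔤 h₀ 0 ↔ ∃ h : h₀, ((h : degreeZero 𝔤) : L) = x := by
  rw [weightComponent_eq_genComponent]
  exact mem_genComponent_zero 𝔤 h₀

lemma exists_killingForm_ne_zero {p : GradedWeight 𝔤 h₀} {x : L}
    (hx : x ∈ weightComponent 𝔤 h₀ p) (hx0 : x ≠ 0) :
    ∃ y ∈ weightComponent 𝔤 h₀ (-p), killingForm ℂ L x y ≠ 0 := by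
  contrapose! hx0
  exact eq_zero_of_killingForm_eq_zero (iSupIndep_weightComponent 𝔤 h₀)
    (iSup_weightComponent 𝔤 h₀) (fun _ _ _ _ => lie_mem_weightComponent) hx hx0

lemma weightComponent_neg_ne_bot {p : GradedWeight 𝔤 h₀} (hp : weightComponent 𝔤 h₀ p ≠ ⊥) :
    weightComponent 𝔤 h₀ (-p) ≠ ⊥ := by
  obtain ⟨x, hx, hx0⟩ := Submodule.exists_mem_ne_zero_of_ne_bot hp
  obtain ⟨y, hy, hxy⟩ := exists_killingForm_ne_zero hx hx0
  refine (Submodule.ne_bot_iff _).mpr ⟨y, hy, ?_⟩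
  rintro rfl
  simp at hxy

variable (𝔤 h₀)

lemma finite_weightComponent_ne_bot : {p | weightComponent 𝔤 h₀ p ≠ ⊥}.Finite :=
  WellFoundedGT.finite_ne_bot_of_iSupIndep (iSupIndep_weightComponent 𝔤 h₀)

lemma traceForm_injective : Function.Injective (traceForm ℂ h₀ L) := by
  rw [injective_iff_map_eq_zero]
  intro h hh
  have : ((h : degreeZero 𝔤) : L) = 0 := by
    refine eq_zero_of_killingForm_eq_zero (iSupIndep_weightComponent 𝔤 h₀)
      (iSup_weightComponent 𝔤 h₀) (fun _ _ _ _ => lie_mem_weightComponent) (p := 0)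
      (mem_weightComponent_zero.mpr ⟨h, rfl⟩) fun y hy => ?_
    rw [neg_zero] at hy
    obtain ⟨g, rfl⟩ := mem_weightComponent_zero.mp hy
    exact LinearMap.congr_fun hh g
  exact Subtype.ext (Subtype.ext this)

/-- The isomorphism `𝔥₀ ≃ 𝔥₀*` given by the Killing form of `𝔤`. -/
def cartanEquiv : h₀ ≃ₗ[ℂ] Dual ℂ h₀ :=
  (traceForm ℂ h₀ L).linearEquivOfInjective (traceForm_injective 𝔤 h₀)
    (Subspace.dual_finrank_eq).symm

/-- The element `t_μ` of `𝔥₀` that represents the linear form `μ` for the Killing form. -/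
def dualVector (μ : Dual ℂ h₀) : h₀ := (cartanEquiv 𝔤 h₀).symm μ

lemma killingForm_dualVector (μ : Dual ℂ h₀) (h : h₀) :
    killingForm ℂ L ((dualVector 𝔤 h₀ μ : degreeZero 𝔤) : L) ((h : degreeZero 𝔤) : L) = μ h :=
  LinearMap.congr_fun ((cartanEquiv 𝔤 h₀).apply_symm_apply μ) h

lemma apply_dualVector_comm (μ ν : Dual ℂ h₀) :
    μ (dualVector 𝔤 h₀ ν) = ν (dualVector 𝔤 h₀ μ) := by
  rw [← killingForm_dualVector, ← killingForm_dualVector, traceForm_comm]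

variable {𝔤 h₀}

lemma lie_eq_killingForm_smul {p : GradedWeight 𝔤 h₀} {x y : L}
    (hx : x ∈ weightComponent 𝔤 h₀ p) (hy : y ∈ weightComponent 𝔤 h₀ (-p)) :
    ⁅x, y⁆ = killingForm ℂ L x y • ((dualVector 𝔤 h₀ p.1 : degreeZero 𝔤) : L) := by
  have h0 := lie_mem_weightComponent hx hy
  rw [add_neg_cancel] at h0
  obtain ⟨g, hg⟩ := mem_weightComponent_zero.mp h0
  have : g = killingForm ℂ L x y • dualVector 𝔤 h₀ p.1 := by
    refine traceForm_injective 𝔤 h₀ (LinearMap.ext fun h => ?_)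
    have h1 : traceForm ℂ h₀ L g h = killingForm ℂ L ⁅x, y⁆ ((h : degreeZero 𝔤) : L) := by
      rw [← hg]
      rfl
    have h2 : ⁅y, ((h : degreeZero 𝔤) : L)⁆ = p.1 h • y := by
      rw [← lie_skew, lie_eq_smul_of_mem_weightComponent h hy]
      simp
    rw [h1, traceForm_apply_lie_apply, h2, map_smul, map_smul, LinearMap.smul_apply]
    have h3 : traceForm ℂ h₀ L (dualVector 𝔤 h₀ p.1) h = p.1 h := killingForm_dualVector 𝔤 h₀ _ h
    rw [h3, smul_eq_mul, smul_eq_mul, mul_comm]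
  rw [← hg, this]
  rfl

lemma eq_zero_of_forall_weightComponent {h : h₀}
    (hh : ∀ q : GradedWeight 𝔤 h₀, weightComponent 𝔤 h₀ q ≠ ⊥ → q.1 h = 0) : h = 0 := by
  have : ((h : degreeZero 𝔤) : L) = 0 := by
    refine eq_zero_of_forall_lie_eq_zero fun w => ?_
    have hw : w ∈ ⨆ p, weightComponent 𝔤 h₀ p := iSup_weightComponent 𝔤 h₀ ▸ Submodule.mem_top
    induction hw using Submodule.iSup_induction' with
    | mem q z hz =>
      rw [lie_eq_smul_of_mem_weightComponent h hz]
      by_cases hq : weightComponent 𝔤 h₀ q = ⊥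
      · rw [hq, Submodule.mem_bot] at hz
        rw [hz, smul_zero]
      · rw [hh q hq, zero_smul]
    | zero => simp
    | add u v _ _ hu hv => rw [lie_add, hu, hv, add_zero]
  exact Subtype.ext (Subtype.ext this)

lemma apply_dualVector_self_ne_zero {p : GradedWeight 𝔤 h₀} (hp : weightComponent 𝔤 h₀ p ≠ ⊥)
    (hp0 : p.1 ≠ 0) : p.1 (dualVector 𝔤 h₀ p.1) ≠ 0 := by
  intro h
  obtain ⟨x, hx, hx0⟩ := Submodule.exists_mem_ne_zero_of_ne_bot hp
  obtain ⟨y, hy, hxy⟩ := exists_killingForm_ne_zero hx hx0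
  have hlie := lie_eq_killingForm_smul hx hy
  suffices dualVector 𝔤 h₀ p.1 = 0 from hp0 <|
    (cartanEquiv 𝔤 h₀).symm.injective (this.trans (map_zero _).symm)
  refine eq_zero_of_forall_weightComponent fun q hq => ?_
  obtain ⟨z, hz, hz0⟩ := Submodule.exists_mem_ne_zero_of_ne_bot hq
  have hyx : ⁅(killingForm ℂ L x y)⁻¹ • x, y⁆ =
      ((dualVector 𝔤 h₀ p.1 : degreeZero 𝔤) : L) := by
    rw [smul_lie, hlie, smul_smul, inv_mul_cancel₀ hxy, one_smul]
  refine eq_zero_of_lie_lie_eq_zero hyx ?_ ?_ hz0 (lie_eq_smul_of_mem_weightComponent _ hz)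
  · rw [lie_smul, lie_eq_smul_of_mem_weightComponent _ hx, h, zero_smul, smul_zero]
  · rw [lie_eq_smul_of_mem_weightComponent _ hy]
    simp [h]

variable (𝔤 h₀) in
/-- The coroot `2 t_μ / μ(t_μ)` of a linear form `μ`; it is only of interest if `μ` is a nonzero
weight, so that `μ(t_μ) ≠ 0`. -/
def corootVector (μ : Dual ℂ h₀) : h₀ := (2 / μ (dualVector 𝔤 h₀ μ)) • dualVector 𝔤 h₀ μ

lemma exists_isSl2Triple {p : GradedWeight 𝔤 h₀} (hp0 : p.1 ≠ 0) {x : L}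
    (hx : x ∈ weightComponent 𝔤 h₀ p) (hx0 : x ≠ 0) :
    ∃ f ∈ weightComponent 𝔤 h₀ (-p),
      IsSl2Triple ((corootVector 𝔤 h₀ p.1 : degreeZero 𝔤) : L) x f := by
  have hne := apply_dualVector_self_ne_zero ((Submodule.ne_bot_iff _).mpr ⟨x, hx, hx0⟩) hp0
  obtain ⟨y, hy, hxy⟩ := exists_killingForm_ne_zero hx hx0
  have h2 : p.1 (corootVector 𝔤 h₀ p.1) = 2 := by
    rw [corootVector, map_smul, smul_eq_mul, div_mul_cancel₀ _ hne]
  have hf := (weightComponent 𝔤 h₀ (-p)).smul_mem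
    (2 / p.1 (dualVector 𝔤 h₀ p.1) * (killingForm ℂ L x y)⁻¹) hy
  refine ⟨_, hf, ?_, ?_, ?_, ?_⟩
  · intro h
    have : corootVector 𝔤 h₀ p.1 = 0 := Subtype.ext (Subtype.ext h)
    rw [this, map_zero] at h2
    exact two_ne_zero h2.symm
  · rw [lie_smul, lie_eq_killingForm_smul hx hy, smul_smul, mul_assoc, inv_mul_cancel₀ hxy,
      mul_one]
    rfl
  · rw [lie_eq_smul_of_mem_weightComponent _ hx, h2, two_smul, two_smul]
  · rw [lie_eq_smul_of_mem_weightComponent _ hf, Prod.fst_neg, LinearMap.neg_apply, h2, neg_smul,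
      two_smul, two_smul]

/-- A vector whose weight is not zero acts nilpotently, since there are only finitely many
weights. -/
lemma exists_pow_ad_eq_zero {p q : GradedWeight 𝔤 h₀} (hp0 : p.1 ≠ 0) {x v : L}
    (hx : x ∈ weightComponent 𝔤 h₀ p) (hv : v ∈ weightComponent 𝔤 h₀ q) (hv0 : v ≠ 0) :
    ∃ k : ℕ, ((toEnd ℂ L L x) ^ k) v ≠ 0 ∧ ((toEnd ℂ L L x) ^ (k + 1)) v = 0 := by
  refine Nat.exists_not_and_succ_of_not_zero_of_exists (by simpa using hv0) ?_
  by_contra! h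
  have hinj : Function.Injective fun k : ℕ => q + k • p := by
    intro k l hkl
    have h1 : k • p.1 = l • p.1 := congrArg Prod.fst (add_left_cancel hkl)
    rw [← Nat.cast_smul_eq_nsmul ℂ, ← Nat.cast_smul_eq_nsmul ℂ] at h1
    exact_mod_cast smul_left_injective ℂ hp0 h1
  refine Set.infinite_range_of_injective hinj
    ((finite_weightComponent_ne_bot 𝔤 h₀).subset ?_)
  rintro _ ⟨k, rfl⟩
  exact (Submodule.ne_bot_iff _).mpr ⟨_, pow_ad_mem hx hv k, h k⟩

lemma exists_int_apply_corootVector {p q : GradedWeight 𝔤 h₀}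
    (hp : weightComponent 𝔤 h₀ p ≠ ⊥) (hp0 : p.1 ≠ 0) (hq : weightComponent 𝔤 h₀ q ≠ ⊥) :
    ∃ m : ℤ, q.1 (corootVector 𝔤 h₀ p.1) = m := by
  obtain ⟨x, hx, hx0⟩ := Submodule.exists_mem_ne_zero_of_ne_bot hp
  obtain ⟨v, hv, hv0⟩ := Submodule.exists_mem_ne_zero_of_ne_bot hq
  obtain ⟨f, -, t⟩ := exists_isSl2Triple hp0 hx hx0
  obtain ⟨k, hk, hk'⟩ := exists_pow_ad_eq_zero hp0 hx hv hv0
  have P : t.HasPrimitiveVectorWith (((toEnd ℂ L L x) ^ k) v)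
      (q.1 (corootVector 𝔤 h₀ p.1) + 2 * k) :=
    ⟨hk, t.lie_h_pow_toEnd_e (lie_eq_smul_of_mem_weightComponent _ hv) k, by
      rw [← toEnd_apply_apply ℂ, ← Module.End.mul_apply, ← pow_succ', hk']⟩
  obtain ⟨m, hm⟩ := P.exists_nat
  exact ⟨m - 2 * k, by push_cast; rw [← hm]; ring⟩

/-- For a nonzero weight `μ`, the number `μ(t_μ)` is real and positive: by integrality of the
coroot, `c = μ(t_μ)` satisfies `c = (c² / 4) s` with `s` a sum of squares of integers. -/
lemma exists_pos_apply_dualVector_self {p : GradedWeight 𝔤 h₀}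
    (hp : weightComponent 𝔤 h₀ p ≠ ⊥) (hp0 : p.1 ≠ 0) :
    ∃ r : ℝ, 0 < r ∧ p.1 (dualVector 𝔤 h₀ p.1) = r := by
  set c := p.1 (dualVector 𝔤 h₀ p.1) with hc
  have hc0 : c ≠ 0 := apply_dualVector_self_ne_zero hp hp0
  have hint (χ : Weight ℂ h₀ L) : ∃ m : ℤ, χ (corootVector 𝔤 h₀ p.1) = m := by
    obtain ⟨j, hj⟩ : ∃ j, weightComponent 𝔤 h₀ (χ.toLinear, j) ≠ ⊥ := by
      simp_rw [weightComponent_eq_genComponent]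
      exact exists_genComponent_ne_bot 𝔤 h₀ χ
    exact exists_int_apply_corootVector hp hp0 hj
  choose m hm using hint
  have ht : dualVector 𝔤 h₀ p.1 = (c / 2) • corootVector 𝔤 h₀ p.1 := by
    rw [corootVector, smul_smul, div_mul_div_cancel₀ two_ne_zero, div_self hc0, one_smul]
  have hsum := killingForm_eq_sum 𝔤 h₀ (dualVector 𝔤 h₀ p.1) (dualVector 𝔤 h₀ p.1)
  rw [killingForm_dualVector, ← hc] at hsum
  have hχ (χ : Weight ℂ h₀ L) : χ (dualVector 𝔤 h₀ p.1) = c / 2 * m χ := by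
    rw [← hm χ, ht]
    exact (χ.toLinear).map_smul _ _
  simp only [hχ] at hsum
  set s : ℝ := ∑ χ : Weight ℂ h₀ L, finrank ℂ (genWeightSpace L χ) * (m χ : ℝ) ^ 2 with hs
  have hcs : c = c ^ 2 / 4 * s := by
    conv_lhs => rw [hsum]
    rw [hs]
    push_cast
    rw [Finset.mul_sum]
    refine Finset.sum_congr rfl fun χ _ => ?_
    rw [nsmul_eq_mul]
    ring
  have hs4 : c * s = 4 := by
    have : c * (c * s - 4) = 0 := by linear_combination (-4 : ℂ) * hcs
    exact sub_eq_zero.mp ((mul_eq_zero.mp this).resolve_left hc0)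
  have hs0 : 0 ≤ s := Finset.sum_nonneg fun χ _ => by positivity
  have hs1 : s ≠ 0 := by
    rintro h
    rw [h] at hs4
    norm_num at hs4
  have hs2 : 0 < s := lt_of_le_of_ne hs0 hs1.symm
  refine ⟨4 / s, by positivity, ?_⟩
  push_cast
  rw [eq_div_iff (by exact_mod_cast hs1)]
  exact hs4

end Roots

/-! ### Representations of `𝔰𝔩₂` -/

/-- In a finite-dimensional representation of `𝔰𝔩₂`, the square of `e` is injective on vectors of
weight `-2`. Otherwise `e v` would be a vector of weight zero annihilated by `e`, hence by `f`, and
then no vector `f ^ k v` could vanish. -/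
lemma lie_lie_ne_zero_of_isSl2Triple {L : Type*} [LieRing L] [LieAlgebra ℂ L]
    [FiniteDimensional ℂ L] {h e f v : L} (t : IsSl2Triple h e f) (hv : v ≠ 0)
    (hhv : ⁅h, v⁆ = (-2 : ℂ) • v)
    (hf : ∃ k : ℕ, ((toEnd ℂ L L f) ^ k) v ≠ 0 ∧ ((toEnd ℂ L L f) ^ (k + 1)) v = 0) :
    ⁅e, ⁅e, v⁆⁆ ≠ 0 := by
  intro hee
  have hev : ⁅e, v⁆ ≠ 0 := by
    intro h0
    have P : t.HasPrimitiveVectorWith v (-2 : ℂ) := ⟨hv, hhv, h0⟩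
    obtain ⟨m, hm⟩ := P.exists_nat
    have : (((-2 : ℤ)) : ℂ) = ((m : ℤ) : ℂ) := by push_cast; exact hm
    have := Int.cast_injective this
    lia
  have hhev : ⁅h, ⁅e, v⁆⁆ = (0 : ℂ) • ⁅e, v⁆ := by
    rw [leibniz_lie, t.lie_h_e_smul ℂ, hhv, lie_smul, smul_lie, ← add_smul]
    norm_num
  have P : t.HasPrimitiveVectorWith ⁅e, v⁆ (0 : ℂ) := ⟨hev, hhev, hee⟩
  have hfev : ⁅f, ⁅e, v⁆⁆ = 0 := by
    simpa using P.pow_toEnd_f_eq_zero_of_eq_nat (n := 0) (by simp)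
  have hweight (k : ℕ) : ⁅h, ((toEnd ℂ L L f) ^ k) v⁆ =
      (-2 - 2 * k : ℂ) • ((toEnd ℂ L L f) ^ k) v := by
    have := t.symm.lie_h_pow_toEnd_e (R := ℂ) (m := v) (μ := 2)
      (by rw [neg_lie, hhv, neg_smul, neg_neg]) k
    rw [neg_lie, neg_eq_iff_eq_neg] at this
    rw [this, ← neg_smul]
    congr 1
    ring
  have hstep (k : ℕ) : ⁅e, ((toEnd ℂ L L f) ^ (k + 1)) v⁆ =
      (-(k + 1) * (k + 2) : ℂ) • ((toEnd ℂ L L f) ^ k) v := by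
    induction k with
    | zero =>
      rw [zero_add, pow_one, toEnd_apply_apply, pow_zero, Module.End.one_apply, leibniz_lie,
        t.lie_e_f, hfev, hhv, add_zero]
      norm_num
    | succ k ih =>
      rw [pow_succ', Module.End.mul_apply, toEnd_apply_apply, leibniz_lie, t.lie_e_f, ih, hweight,
        lie_smul, ← toEnd_apply_apply ℂ L L f, ← Module.End.mul_apply, ← pow_succ', ← add_smul]
      congr 1
      push_cast
      ring
  obtain ⟨k, hk, hk'⟩ := hf
  have := hstep k
  rw [hk', lie_zero, eq_comm, smul_eq_zero] at this
  refine hk (this.resolve_left (mul_ne_zero (neg_ne_zero.mpr ?_) ?_))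
  · exact_mod_cast Nat.succ_ne_zero k
  · exact_mod_cast Nat.succ_ne_zero (k + 1)

/-! ### Real roots -/

section RealRoots

variable {n : ℕ} {L : Type*} [LieRing L] [LieAlgebra ℂ L]
variable {𝔤 : ZMod n → Submodule ℂ L} [GradedLieAlgebra 𝔤] {h₀ : LieSubalgebra ℂ (degreeZero 𝔤)}

variable (𝔤 h₀) in
/-- A real root: a pair `(μ, j)` with `μ` a nonzero weight of `𝔤_j`. These are the images of the
real roots of the affine Lie algebra attached to the grading. -/
def IsRealRoot (p : GradedWeight 𝔤 h₀) : Prop := weightComponent 𝔤 h₀ p ≠ ⊥ ∧ p.1 ≠ 0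

variable [FiniteDimensional ℂ L] [IsKilling ℂ L] [h₀.IsCartanSubalgebra]

lemma IsRealRoot.neg {p : GradedWeight 𝔤 h₀} (hp : IsRealRoot 𝔤 h₀ p) : IsRealRoot 𝔤 h₀ (-p) :=
  ⟨weightComponent_neg_ne_bot hp.1, neg_ne_zero.mpr hp.2⟩

variable (𝔤 h₀) in
/-- The bilinear form on `𝔥₀*` induced by the Killing form, or rather its real part; on weights the
values are real anyway. -/
def weightForm (μ : Dual ℂ h₀) : Dual ℂ h₀ →+ ℝ where
  toFun ν := (ν (dualVector 𝔤 h₀ μ)).re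
  map_zero' := by simp
  map_add' := by simp

lemma weightForm_comm (μ ν : Dual ℂ h₀) : weightForm 𝔤 h₀ μ ν = weightForm 𝔤 h₀ ν μ :=
  congrArg Complex.re (apply_dualVector_comm 𝔤 h₀ ν μ)

lemma weightForm_self_pos {p : GradedWeight 𝔤 h₀} (hp : IsRealRoot 𝔤 h₀ p) :
    0 < weightForm 𝔤 h₀ p.1 p.1 := by
  obtain ⟨r, hr, hr'⟩ := exists_pos_apply_dualVector_self hp.1 hp.2
  change 0 < (p.1 (dualVector 𝔤 h₀ p.1)).re
  rwa [hr', Complex.ofReal_re]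

lemma apply_corootVector_self {p : GradedWeight 𝔤 h₀} (hp : IsRealRoot 𝔤 h₀ p) :
    p.1 (corootVector 𝔤 h₀ p.1) = 2 := by
  rw [corootVector, map_smul, smul_eq_mul,
    div_mul_cancel₀ _ (apply_dualVector_self_ne_zero hp.1 hp.2)]

/-- Root vectors act injectively on weight spaces that are in the negative half of the root
string. -/
lemma lie_ne_zero_of_weightForm_neg {p q : GradedWeight 𝔤 h₀} (hp0 : p.1 ≠ 0) {x y : L}
    (hx : x ∈ weightComponent 𝔤 h₀ p) (hx0 : x ≠ 0) (hy : y ∈ weightComponent 𝔤 h₀ q)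
    (hy0 : y ≠ 0) (hpq : weightForm 𝔤 h₀ p.1 q.1 < 0) : ⁅x, y⁆ ≠ 0 := by
  intro hxy
  obtain ⟨f, -, t⟩ := exists_isSl2Triple hp0 hx hx0
  have P : t.HasPrimitiveVectorWith y (q.1 (corootVector 𝔤 h₀ p.1)) :=
    ⟨hy0, lie_eq_smul_of_mem_weightComponent _ hy, hxy⟩
  obtain ⟨m, hm⟩ := P.exists_nat
  obtain ⟨r, hr, hr'⟩ :=
    exists_pos_apply_dualVector_self ((Submodule.ne_bot_iff _).mpr ⟨x, hx, hx0⟩) hp0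
  rw [corootVector, map_smul, smul_eq_mul, hr'] at hm
  have hr0 : (r : ℂ) ≠ 0 := by exact_mod_cast hr.ne'
  have hval : q.1 (dualVector 𝔤 h₀ p.1) = ((m * r / 2 : ℝ) : ℂ) := by
    push_cast
    rw [← hm]
    field_simp
  change (q.1 (dualVector 𝔤 h₀ p.1)).re < 0 at hpq
  rw [hval, Complex.ofReal_re] at hpq
  have : (0 : ℝ) ≤ m * r / 2 := by positivity
  linarith

lemma weightComponent_add_ne_bot {p q : GradedWeight 𝔤 h₀} (hp : IsRealRoot 𝔤 h₀ p)
    (hq : weightComponent 𝔤 h₀ q ≠ ⊥) (hpq : weightForm 𝔤 h₀ p.1 q.1 < 0) :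
    weightComponent 𝔤 h₀ (p + q) ≠ ⊥ := by
  obtain ⟨x, hx, hx0⟩ := Submodule.exists_mem_ne_zero_of_ne_bot hp.1
  obtain ⟨y, hy, hy0⟩ := Submodule.exists_mem_ne_zero_of_ne_bot hq
  exact (Submodule.ne_bot_iff _).mpr ⟨_, lie_mem_weightComponent hx hy,
    lie_ne_zero_of_weightForm_neg hp.2 hx hx0 hy hy0 hpq⟩

lemma weightComponent_sub_ne_bot {p q : GradedWeight 𝔤 h₀} (hp : IsRealRoot 𝔤 h₀ p)
    (hq : weightComponent 𝔤 h₀ q ≠ ⊥) (hpq : 0 < weightForm 𝔤 h₀ p.1 q.1) :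
    weightComponent 𝔤 h₀ (q - p) ≠ ⊥ := by
  rw [sub_eq_neg_add]
  refine weightComponent_add_ne_bot hp.neg hq ?_
  rw [weightForm_comm, Prod.fst_neg, map_neg, weightForm_comm]
  linarith

/-- Real root spaces are one-dimensional. -/
lemma exists_eq_smul {p : GradedWeight 𝔤 h₀} (hp0 : p.1 ≠ 0) {x y : L}
    (hx : x ∈ weightComponent 𝔤 h₀ p) (hx0 : x ≠ 0) (hy : y ∈ weightComponent 𝔤 h₀ p) :
    ∃ c : ℂ, y = c • x := by
  obtain ⟨f, hf, t⟩ := exists_isSl2Triple hp0 hx hx0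
  have hκ : killingForm ℂ L x f ≠ 0 := by
    intro h
    have := lie_eq_killingForm_smul hx hf
    rw [h, zero_smul, t.lie_e_f] at this
    exact t.h_ne_zero this
  set c := killingForm ℂ L y f / killingForm ℂ L x f
  refine ⟨c, ?_⟩
  rw [← sub_eq_zero]
  by_contra hz
  have hzm : y - c • x ∈ weightComponent 𝔤 h₀ p :=
    Submodule.sub_mem _ hy (Submodule.smul_mem _ _ hx)
  have hfz : ⁅f, y - c • x⁆ = 0 := by
    rw [← lie_skew, lie_eq_killingForm_smul hzm hf, map_sub, map_smul, LinearMap.sub_apply,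
      LinearMap.smul_apply, smul_eq_mul, div_mul_cancel₀ _ hκ, sub_self, zero_smul, neg_zero]
  have P : t.symm.HasPrimitiveVectorWith (y - c • x) (-2 : ℂ) := by
    refine ⟨hz, ?_, hfz⟩
    rw [neg_lie, lie_eq_smul_of_mem_weightComponent _ hzm, neg_smul,
      apply_corootVector_self ⟨(Submodule.ne_bot_iff _).mpr ⟨x, hx, hx0⟩, hp0⟩]
  obtain ⟨m, hm⟩ := P.exists_nat
  have : (((-2 : ℤ)) : ℂ) = ((m : ℤ) : ℂ) := by push_cast; exact hm
  have := Int.cast_injective this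
  lia

/-- The bracket of two real root spaces is nonzero whenever the sum is a weight. If the form is
negative on the two roots, this is the injectivity on the negative half of the string; otherwise it
follows by duality from the same statement for `p` and `-(p + q)`, as the root space of `-q` is
one-dimensional. -/
lemma lie_ne_zero_of_weightComponent_add_ne_bot {p q : GradedWeight 𝔤 h₀} (hp0 : p.1 ≠ 0)
    (hq0 : q.1 ≠ 0) {x y : L} (hx : x ∈ weightComponent 𝔤 h₀ p) (hx0 : x ≠ 0)
    (hy : y ∈ weightComponent 𝔤 h₀ q) (hy0 : y ≠ 0)
    (hpq : weightComponent 𝔤 h₀ (p + q) ≠ ⊥) : ⁅x, y⁆ ≠ 0 := by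
  by_cases hneg : weightForm 𝔤 h₀ p.1 q.1 < 0
  · exact lie_ne_zero_of_weightForm_neg hp0 hx hx0 hy hy0 hneg
  have hp : IsRealRoot 𝔤 h₀ p := ⟨(Submodule.ne_bot_iff _).mpr ⟨x, hx, hx0⟩, hp0⟩
  have hpp := weightForm_self_pos hp
  obtain ⟨w, hw, hw0⟩ := Submodule.exists_mem_ne_zero_of_ne_bot (weightComponent_neg_ne_bot hpq)
  have hxw : ⁅x, w⁆ ≠ 0 := by
    refine lie_ne_zero_of_weightForm_neg hp0 hx hx0 hw hw0 ?_
    rw [Prod.fst_neg, Prod.fst_add, map_neg, map_add]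
    linarith
  have hxw' : ⁅x, w⁆ ∈ weightComponent 𝔤 h₀ (-q) := by
    have := lie_mem_weightComponent hx hw
    rwa [neg_add, add_neg_cancel_left] at this
  obtain ⟨u, hu, hyu⟩ := exists_killingForm_ne_zero hy hy0
  obtain ⟨c, rfl⟩ := exists_eq_smul (neg_ne_zero.mpr hq0) hxw' hxw hu
  intro hxy
  apply hyu
  rw [map_smul, ← traceForm_apply_lie_apply, ← lie_skew, hxy]
  simp

end RealRoots

/-! ### Positive roots and the cone they generate -/

section Order

lemma exists_mem_neg_of_sum_neg {X : Type*} [AddCommMonoid X] (f : X →+ ℝ) {s : Multiset X}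
    (h : f s.sum < 0) : ∃ a ∈ s, f a < 0 := by
  contrapose! h
  rw [map_multiset_sum]
  exact Multiset.sum_nonneg fun y hy => by
    obtain ⟨a, ha, rfl⟩ := Multiset.mem_map.mp hy
    exact h a ha

lemma exists_mem_pos_of_sum_pos {X : Type*} [AddCommMonoid X] (f : X →+ ℝ) {s : Multiset X}
    (h : 0 < f s.sum) : ∃ a ∈ s, 0 < f a := by
  obtain ⟨a, ha, h'⟩ := exists_mem_neg_of_sum_neg (-f) (s := s) (by simpa using h)
  exact ⟨a, ha, by simpa using h'⟩

/-- The order defined by a pointed cone is well founded on finite sets. -/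
lemma wellFoundedOn_of_pointed {X : Type*} [AddCommGroup X] {C : AddSubmonoid X}
    (hC : ∀ x ∈ C, -x ∈ C → x = 0) {s : Set X} (hs : s.Finite) :
    s.WellFoundedOn fun x y => y - x ∈ C ∧ y - x ≠ 0 := by
  have : IsStrictOrder X fun x y => y - x ∈ C ∧ y - x ≠ 0 :=
    { irrefl := fun x h => h.2 (sub_self x)
      trans := fun x y z hxy hyz => by
        have hadd : z - x = (z - y) + (y - x) := by abel
        refine ⟨hadd ▸ C.add_mem hyz.1 hxy.1, fun h => hxy.2 (hC _ hxy.1 ?_)⟩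
        have : -(y - x) = z - y := by
          rw [hadd] at h
          exact (eq_neg_of_add_eq_zero_left h).symm
        exact this ▸ hyz.1 }
  exact hs.wellFoundedOn

end Order

section PositiveRoots

variable {n : ℕ} {L : Type*} [LieRing L] [LieAlgebra ℂ L]
variable {𝔤 : ZMod n → Submodule ℂ L} [GradedLieAlgebra 𝔤] {h₀ b₀ : LieSubalgebra ℂ (degreeZero 𝔤)}

lemma isRealRoot_of_mem_positiveRoots {α : Dual ℂ h₀} (hα : α ∈ positiveRoots 𝔤 h₀ b₀) :
    IsRealRoot 𝔤 h₀ (α, 0) := by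
  obtain ⟨h0, e, -, he0, he⟩ := hα
  exact ⟨(Submodule.ne_bot_iff _).mpr ⟨_, he, by simpa using he0⟩, h0⟩

variable [FiniteDimensional ℂ L] [IsKilling ℂ L] [h₀.IsCartanSubalgebra]

/-- Root vectors for opposite roots generate a copy of `𝔰𝔩₂`, which is not solvable. -/
lemma neg_notMem_positiveRoots (hb₀ : LieAlgebra.IsSolvable b₀) {α : Dual ℂ h₀}
    (hα : α ∈ positiveRoots 𝔤 h₀ b₀) : -α ∉ positiveRoots 𝔤 h₀ b₀ := by
  intro hα'
  have hroot := isRealRoot_of_mem_positiveRoots hα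
  have hpos := weightForm_self_pos hroot
  obtain ⟨hα0, e, heb, he0, he⟩ := hα
  obtain ⟨-, f, hfb, hf0, hf⟩ := hα'
  have hef : ⁅(e : L), (f : L)⁆ ≠ 0 :=
    lie_ne_zero_of_weightForm_neg hα0 he (by simpa using he0) hf (by simpa using hf0)
      (by simpa using hpos)
  have hf' : (f : L) ∈ weightComponent 𝔤 h₀ (-(α, 0)) := by
    rwa [Prod.neg_mk, neg_zero]
  have hκ := lie_eq_killingForm_smul he hf'
  set κ := killingForm ℂ L e f
  have hκ0 : κ ≠ 0 := by
    intro h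
    rw [h, zero_smul] at hκ
    exact hef hκ
  set c := α (dualVector 𝔤 h₀ α)
  have hc0 : c ≠ 0 := apply_dualVector_self_ne_zero hroot.1 hα0
  let e' : b₀ := ⟨e, heb⟩
  let f' : b₀ := ⟨f, hfb⟩
  have hhe : ⁅⁅e', f'⁆, e'⁆ = (κ * c) • e' := by
    refine Subtype.ext (Subtype.ext ?_)
    change ⁅⁅(e : L), (f : L)⁆, (e : L)⁆ = (κ * c) • (e : L)
    rw [hκ, smul_lie, lie_eq_smul_of_mem_weightComponent _ he, smul_smul]
  have hhf : ⁅⁅e', f'⁆, f'⁆ = (-(κ * c)) • f' := by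
    refine Subtype.ext (Subtype.ext ?_)
    change ⁅⁅(e : L), (f : L)⁆, (f : L)⁆ = (-(κ * c)) • (f : L)
    rw [hκ, smul_lie, lie_eq_smul_of_mem_weightComponent _ hf, smul_smul, LinearMap.neg_apply,
      mul_neg]
  have hmem (k : ℕ) : e' ∈ derivedSeries ℂ b₀ k ∧ f' ∈ derivedSeries ℂ b₀ k := by
    induction k with
    | zero => exact ⟨LieSubmodule.mem_top _, LieSubmodule.mem_top _⟩
    | succ k ih =>
      have hk : ⁅e', f'⁆ ∈ derivedSeries ℂ b₀ k := lie_mem_left ℂ _ _ _ _ ih.1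
      have hkc : κ * c ≠ 0 := mul_ne_zero hκ0 hc0
      rw [derivedSeries_def, derivedSeriesOfIdeal_succ]
      constructor
      · have := LieSubmodule.lie_mem_lie hk ih.1
        rw [hhe] at this
        exact ((LieSubmodule.toSubmodule _).smul_mem_iff hkc).mp this
      · have := LieSubmodule.lie_mem_lie hk ih.2
        rw [hhf] at this
        exact ((LieSubmodule.toSubmodule _).smul_mem_iff (neg_ne_zero.mpr hkc)).mp this
  obtain ⟨k, hk⟩ := IsSolvable.solvable ℂ b₀
  have := (hmem k).1
  rw [hk, LieSubmodule.mem_bot] at this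
  exact he0 (congrArg Subtype.val this)

lemma add_mem_positiveRoots {α β : Dual ℂ h₀} (hα : α ∈ positiveRoots 𝔤 h₀ b₀)
    (hβ : β ∈ positiveRoots 𝔤 h₀ b₀) (hαβ : α + β ≠ 0)
    (hroot : weightComponent 𝔤 h₀ (α + β, 0) ≠ ⊥) : α + β ∈ positiveRoots 𝔤 h₀ b₀ := by
  obtain ⟨hα0, e, heb, he0, he⟩ := hα
  obtain ⟨hβ0, f, hfb, hf0, hf⟩ := hβ
  have hadd : ((α, 0) + (β, 0) : GradedWeight 𝔤 h₀) = (α + β, 0) := by simp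
  have hmem := lie_mem_weightComponent he hf
  rw [hadd] at hmem
  refine ⟨hαβ, ⁅e, f⁆, b₀.lie_mem heb hfb, fun h => ?_, hmem⟩
  refine lie_ne_zero_of_weightComponent_add_ne_bot hα0 hβ0 he (by simpa using he0) hf
    (by simpa using hf0) (by rwa [hadd]) ?_
  exact congrArg Subtype.val h

/-- A nonempty sum of positive roots is not zero. In a shortest vanishing sum, a root `α` would
have a negative product with another summand `β`, and `α + β` would be a positive root. -/
lemma sum_ne_zero_of_positiveRoots (hb₀ : LieAlgebra.IsSolvable b₀) (s : Multiset (Dual ℂ h₀))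
    (hs : ∀ α ∈ s, α ∈ positiveRoots 𝔤 h₀ b₀) (hs0 : s ≠ 0) : s.sum ≠ 0 := by
  induction hcard : s.card using Nat.strong_induction_on generalizing s with
  | _ N ih =>
  subst hcard
  intro hsum
  obtain ⟨α, hα⟩ := Multiset.exists_mem_of_ne_zero hs0
  obtain ⟨t, rfl⟩ := Multiset.exists_cons_of_mem hα
  rw [Multiset.sum_cons] at hsum
  have hαP := hs α hα
  have hroot := isRealRoot_of_mem_positiveRoots hαP
  have hpos := weightForm_self_pos hroot
  have ht : weightForm 𝔤 h₀ α t.sum < 0 := by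
    rw [← neg_eq_of_add_eq_zero_right hsum, map_neg]
    simpa using hpos
  obtain ⟨β, hβ, hαβ⟩ := exists_mem_neg_of_sum_neg _ ht
  obtain ⟨u, rfl⟩ := Multiset.exists_cons_of_mem hβ
  have hβP := hs β (by simp)
  have hne : α + β ≠ 0 := by
    intro h
    rw [← neg_eq_of_add_eq_zero_right h] at hβP
    exact neg_notMem_positiveRoots hb₀ hαP hβP
  have hadd : α + β ∈ positiveRoots 𝔤 h₀ b₀ := by
    refine add_mem_positiveRoots hαP hβP hne ?_
    have := weightComponent_add_ne_bot hroot (isRealRoot_of_mem_positiveRoots hβP).1 hαβ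
    simpa using this
  refine ih _ (by simp) ((α + β) ::ₘ u) ?_ (by simp) rfl ?_
  · intro γ hγ
    rcases Multiset.mem_cons.mp hγ with rfl | hγ
    · exact hadd
    · exact hs γ (by simp [hγ])
  · rwa [Multiset.sum_cons, add_assoc, ← Multiset.sum_cons]

lemma eq_zero_of_mem_closure_positiveRoots (hb₀ : LieAlgebra.IsSolvable b₀) {x : Dual ℂ h₀}
    (hx : x ∈ AddSubmonoid.closure (positiveRoots 𝔤 h₀ b₀))
    (hx' : -x ∈ AddSubmonoid.closure (positiveRoots 𝔤 h₀ b₀)) : x = 0 := by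
  obtain ⟨s, hs, rfl⟩ := AddSubmonoid.exists_multiset_of_mem_closure hx
  obtain ⟨t, ht, hst⟩ := AddSubmonoid.exists_multiset_of_mem_closure hx'
  by_contra hne
  refine sum_ne_zero_of_positiveRoots hb₀ (s + t) (fun α hα => ?_) (fun h => ?_) ?_
  · rcases Multiset.mem_add.mp hα with h | h
    · exact hs α h
    · exact ht α h
  · rw [(add_eq_zero.mp h).1] at hne
    exact hne Multiset.sum_zero
  · rw [Multiset.sum_add, hst, add_neg_cancel]

/-- Every positive root is a sum of simple roots. -/
lemma positiveRoots_subset_positiveCone (hb₀ : LieAlgebra.IsSolvable b₀) :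
    positiveRoots 𝔤 h₀ b₀ ⊆ positiveCone 𝔤 h₀ b₀ := by
  intro α hα
  have hfin : (positiveRoots 𝔤 h₀ b₀).Finite := by
    refine ((finite_weightComponent_ne_bot 𝔤 h₀).preimage
      (f := fun α : Dual ℂ h₀ => ((α, 0) : GradedWeight 𝔤 h₀)) (by simp [Set.InjOn])).subset ?_
    exact fun β hβ => (isRealRoot_of_mem_positiveRoots hβ).1
  have hwf := wellFoundedOn_of_pointed (fun x => eq_zero_of_mem_closure_positiveRoots hb₀) hfin
  refine hwf.induction (P := fun β => β ∈ positiveCone 𝔤 h₀ b₀) hα fun β hβ ih => ?_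
  by_cases hsimple : β ∈ simpleRoots 𝔤 h₀ b₀
  · exact AddSubmonoid.subset_closure hsimple
  · have : ∃ γ ∈ positiveRoots 𝔤 h₀ b₀, ∃ δ ∈ positiveRoots 𝔤 h₀ b₀, γ + δ = β := by
      by_contra! h
      exact hsimple ⟨hβ, h⟩
    obtain ⟨γ, hγ, δ, hδ, rfl⟩ := this
    refine AddSubmonoid.add_mem _ (ih γ hγ ?_) (ih δ hδ ?_)
    · rw [add_sub_cancel_left]
      exact ⟨AddSubmonoid.subset_closure hδ, hδ.1⟩
    · rw [add_sub_cancel_right]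
      exact ⟨AddSubmonoid.subset_closure hγ, hγ.1⟩

lemma eq_zero_of_mem_positiveCone (hb₀ : LieAlgebra.IsSolvable b₀) {x : Dual ℂ h₀}
    (hx : x ∈ positiveCone 𝔤 h₀ b₀) (hx' : -x ∈ positiveCone 𝔤 h₀ b₀) : x = 0 :=
  eq_zero_of_mem_closure_positiveRoots hb₀
    (AddSubmonoid.closure_mono (fun _ h => h.1) hx) (AddSubmonoid.closure_mono (fun _ h => h.1) hx')

/-- A root of `𝔤₀` that is a sum of positive roots is a positive root: one of the summands can be
subtracted from it. -/
lemma sum_mem_positiveRoots (s : Multiset (Dual ℂ h₀))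
    (hs : ∀ α ∈ s, α ∈ positiveRoots 𝔤 h₀ b₀) (hs0 : s.sum ≠ 0)
    (hroot : weightComponent 𝔤 h₀ (s.sum, 0) ≠ ⊥) : s.sum ∈ positiveRoots 𝔤 h₀ b₀ := by
  induction hcard : s.card generalizing s with
  | zero => simp [Multiset.card_eq_zero.mp hcard] at hs0
  | succ N ih =>
    obtain ⟨α, hα, hpos⟩ := exists_mem_pos_of_sum_pos _ (weightForm_self_pos ⟨hroot, hs0⟩)
    obtain ⟨t, rfl⟩ := Multiset.exists_cons_of_mem hα
    have hαP := hs α hα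
    have hsub := weightComponent_sub_ne_bot (isRealRoot_of_mem_positiveRoots hαP) hroot
      (by rwa [weightForm_comm])
    simp only [Multiset.sum_cons, Prod.mk_sub_mk, add_sub_cancel_left, sub_self] at hsub
    rw [Multiset.sum_cons] at hs0 hroot ⊢
    by_cases ht : t.sum = 0
    · rwa [ht, add_zero]
    · exact add_mem_positiveRoots hαP
        (ih t (fun β hβ => hs β (Multiset.mem_cons_of_mem hβ)) ht hsub (by simpa using hcard))
        hs0 hroot

/-- Above every weight of `𝔤_j` there is a highest weight. -/
lemma exists_isHighestWeight (hb₀ : LieAlgebra.IsSolvable b₀) {μ : Dual ℂ h₀} {j : ZMod n}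
    (hμ : weightComponent 𝔤 h₀ (μ, j) ≠ ⊥) :
    ∃ lam, IsHighestWeight 𝔤 h₀ b₀ lam j ∧ lam - μ ∈ positiveCone 𝔤 h₀ b₀ := by
  have hfin : {ν | weightComponent 𝔤 h₀ (ν, j) ≠ ⊥}.Finite :=
    (finite_weightComponent_ne_bot 𝔤 h₀).preimage
      (f := fun ν : Dual ℂ h₀ => ((ν, j) : GradedWeight 𝔤 h₀)) (by simp [Set.InjOn])
  -- The opposite cone is used, so that the induction descends from larger weights.
  have hwf := wellFoundedOn_of_pointed
    (C := (positiveCone 𝔤 h₀ b₀).comap (-AddMonoidHom.id (Dual ℂ h₀)))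
    (fun x hx hx' => eq_zero_of_mem_positiveCone hb₀ (by simpa using hx') (by simpa using hx)) hfin
  refine hwf.induction (P := fun μ => ∃ lam, IsHighestWeight 𝔤 h₀ b₀ lam j ∧
    lam - μ ∈ positiveCone 𝔤 h₀ b₀) hμ fun ν hν ih => ?_
  obtain ⟨v, hv, hv0⟩ := Submodule.exists_mem_ne_zero_of_ne_bot hν
  by_cases h : ∀ α ∈ positiveRoots 𝔤 h₀ b₀, ∀ e ∈ weightComponent 𝔤 h₀ (α, 0), ⁅e, v⁆ = 0
  · exact ⟨ν, ⟨v, hv, hv0, h⟩, by simp⟩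
  · push Not at h
    obtain ⟨α, hα, e, he, hev⟩ := h
    have hmem := lie_mem_weightComponent he hv
    rw [Prod.mk_add_mk, zero_add] at hmem
    have hαC := positiveRoots_subset_positiveCone hb₀ hα
    obtain ⟨lam, hlam, hle⟩ := ih (α + ν) ((Submodule.ne_bot_iff _).mpr ⟨_, hmem, hev⟩)
      ⟨by simpa using hαC, by simpa using hα.1⟩
    refine ⟨lam, hlam, ?_⟩
    have : lam - ν = (lam - (α + ν)) + α := by abel
    exact this ▸ AddSubmonoid.add_mem _ hle hαC

variable (b₀) in
/-- A subalgebra of `𝔤₀` that contains `𝔥₀`, as an `𝔥₀`-submodule of `𝔤`. -/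
def borelSubmodule (hle : h₀ ≤ b₀) : LieSubmodule ℂ h₀ L where
  __ := b₀.toSubmodule.map (degreeZero 𝔤).toSubmodule.subtype
  lie_mem := by
    rintro h _ ⟨b, hb, rfl⟩
    exact ⟨⁅(h : degreeZero 𝔤), b⁆, b₀.lie_mem (hle h.2) hb, rfl⟩

lemma mem_iSup_of_mem_borel (hle : h₀ ≤ b₀) {b : degreeZero 𝔤} (hb : b ∈ b₀) :
    (b : L) ∈ ⨆ (α : Dual ℂ h₀) (_ : α = 0 ∨ α ∈ positiveRoots 𝔤 h₀ b₀),
      weightComponent 𝔤 h₀ (α, 0) := by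
  have hN := le_iSup_weightComponent 𝔤 h₀ 0 (borelSubmodule b₀ hle) (by
    rintro _ ⟨c, -, rfl⟩
    exact c.2)
  have hbN : (b : L) ∈ (borelSubmodule b₀ hle).toSubmodule := ⟨b, hb, rfl⟩
  refine (iSup_le (a := ⨆ (α : Dual ℂ h₀) (_ : α = 0 ∨ α ∈ positiveRoots 𝔤 h₀ b₀),
    weightComponent 𝔤 h₀ (α, 0)) fun α => ?_) (hN hbN)
  rintro _ ⟨⟨c, hc, rfl⟩, hcα⟩
  change (c : L) ∈ _ at hcα
  change (c : L) ∈ _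
  by_cases hc0 : c = 0
  · rw [hc0]
    exact Submodule.zero_mem _
  · refine Submodule.mem_iSup_of_mem α (Submodule.mem_iSup_of_mem ?_ hcα)
    exact or_iff_not_imp_left.mpr fun hα => ⟨hα, c, hc, hc0, hcα⟩

end PositiveRoots

/-! ### Abelian module subalgebras -/

section ModuleSubalgebras

variable {n : ℕ} {L : Type*} [LieRing L] [LieAlgebra ℂ L]
variable {𝔤 : ZMod n → Submodule ℂ L} [GradedLieAlgebra 𝔤] {h₀ b₀ : LieSubalgebra ℂ (degreeZero 𝔤)}

lemma weightLE_iff_exists {p q : GradedWeight 𝔤 h₀} :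
    WeightLE 𝔤 h₀ b₀ p q ↔ ∃ c ∈ positiveCone 𝔤 h₀ b₀, q = p + (c, 0) := by
  constructor
  · rintro ⟨h, hc⟩
    exact ⟨_, hc, Prod.ext (by simp) (by simp [h])⟩
  · rintro ⟨c, hc, rfl⟩
    exact ⟨by simp, by simpa using hc⟩

lemma weightLE_refl (p : GradedWeight 𝔤 h₀) : WeightLE 𝔤 h₀ b₀ p p :=
  ⟨rfl, by rw [sub_self]; exact AddSubmonoid.zero_mem _⟩

lemma WeightLE.trans {p q r : GradedWeight 𝔤 h₀} (hpq : WeightLE 𝔤 h₀ b₀ p q)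
    (hqr : WeightLE 𝔤 h₀ b₀ q r) : WeightLE 𝔤 h₀ b₀ p r :=
  ⟨hpq.1.trans hqr.1, by
    rw [← sub_add_sub_cancel]
    exact AddSubmonoid.add_mem _ hqr.2 hpq.2⟩

lemma WeightLE.add {p q p' q' : GradedWeight 𝔤 h₀} (hp : WeightLE 𝔤 h₀ b₀ p p')
    (hq : WeightLE 𝔤 h₀ b₀ q q') : WeightLE 𝔤 h₀ b₀ (p + q) (p' + q') :=
  ⟨congrArg₂ (· + ·) hp.1 hq.1, by
    rw [Prod.fst_add, Prod.fst_add, add_sub_add_comm]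
    exact AddSubmonoid.add_mem _ hp.2 hq.2⟩

lemma IsAbelianModuleSubalgebra.lie_eq_zero {i : LieSubalgebra ℂ L}
    (hi : IsAbelianModuleSubalgebra 𝔤 b₀ i) {x y : L} (hx : x ∈ i) (hy : y ∈ i) :
    ⁅x, y⁆ = 0 := by
  have h := hi.nilpotent
  have hmem : ⁅(⟨x, hx⟩ : i), (⟨y, hy⟩ : i)⁆ ∈ LieModule.lowerCentralSeries ℂ i i 1 := by
    rw [lowerCentralSeries_succ]
    exact LieSubmodule.lie_mem_lie (LieSubmodule.mem_top _) (LieSubmodule.mem_top _)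
  rw [h, LieSubmodule.mem_bot] at hmem
  exact congrArg Subtype.val hmem

variable (𝔤 h₀ b₀) in
/-- The sum of the weight spaces in nonzero degree whose weights lie above an element of `A`. -/
def upperSubmodule (A : Set (GradedWeight 𝔤 h₀)) : Submodule ℂ L :=
  ⨆ (q : GradedWeight 𝔤 h₀) (_ : q.2 ≠ 0 ∧ ∃ p ∈ A, WeightLE 𝔤 h₀ b₀ p q), weightComponent 𝔤 h₀ q

lemma mem_upperSubmodule {A : Set (GradedWeight 𝔤 h₀)} {p q : GradedWeight 𝔤 h₀} (hq : q.2 ≠ 0)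
    (hp : p ∈ A) (hpq : WeightLE 𝔤 h₀ b₀ p q) {x : L} (hx : x ∈ weightComponent 𝔤 h₀ q) :
    x ∈ upperSubmodule 𝔤 h₀ b₀ A :=
  Submodule.mem_iSup_of_mem q (Submodule.mem_iSup_of_mem ⟨hq, p, hp, hpq⟩ hx)

lemma upperSubmodule_induction {A : Set (GradedWeight 𝔤 h₀)} {C : L → Prop}
    (hC : ∀ q : GradedWeight 𝔤 h₀, q.2 ≠ 0 → (∃ p ∈ A, WeightLE 𝔤 h₀ b₀ p q) →
      ∀ x ∈ weightComponent 𝔤 h₀ q, C x)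
    (hzero : C 0) (hadd : ∀ x y, C x → C y → C (x + y)) {x : L}
    (hx : x ∈ upperSubmodule 𝔤 h₀ b₀ A) : C x := by
  refine Submodule.iSup_induction _ (motive := C) hx (fun q z hz => ?_) hzero hadd
  refine Submodule.iSup_induction _ (motive := C) hz (fun hq w hw => ?_) hzero hadd
  exact hC q hq.1 hq.2 w hw

variable [FiniteDimensional ℂ L] [IsKilling ℂ L] [h₀.IsCartanSubalgebra]

/-- The negative of a positive root of `𝔤₀` is not a weight of an abelian module subalgebra: the
subalgebra would contain a vector `x` of that weight and `⁅e, x⁆` for a root vector `e`, but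
`⁅x, ⁅x, e⁆⁆ ≠ 0` by `𝔰𝔩₂`-theory. -/
lemma eq_zero_of_neg_mem_positiveRoots {i : LieSubalgebra ℂ L}
    (hi : IsAbelianModuleSubalgebra 𝔤 b₀ i) {p : GradedWeight 𝔤 h₀}
    (hp : -p.1 ∈ positiveRoots 𝔤 h₀ b₀) {x : L} (hxi : x ∈ i)
    (hx : x ∈ weightComponent 𝔤 h₀ p) : x = 0 := by
  by_contra hx0
  obtain ⟨hneg, e, heb, he0, he⟩ := hp
  have hp0 : p.1 ≠ 0 := neg_ne_zero.mp hneg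
  have he0' : (e : L) ≠ 0 := by simpa using he0
  obtain ⟨f, hf, t⟩ := exists_isSl2Triple hp0 hx hx0
  have hroot : IsRealRoot 𝔤 h₀ p := ⟨(Submodule.ne_bot_iff _).mpr ⟨x, hx, hx0⟩, hp0⟩
  refine lie_lie_ne_zero_of_isSl2Triple t he0' ?_ ?_
    (hi.lie_eq_zero hxi (?_ : ⁅x, (e : L)⁆ ∈ i))
  · rw [lie_eq_smul_of_mem_weightComponent _ he, LinearMap.neg_apply, apply_corootVector_self hroot]
  · exact exists_pow_ad_eq_zero (p := -p) hneg hf he he0'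
  · rw [← lie_skew]
    exact i.neg_mem (hi.borel_stable e heb x hxi)

/-- If `γ` and `δ` are nonzero weights of an abelian module subalgebra `i`, no weight of the
algebra is of the form `γ + δ + s` with `s` a sum of positive roots. The induction on the number of
summands moves `γ` or `δ` up within the weights of `i`. If neither of them can be moved up by a
summand of `s`, then the products of `γ`, `δ` and `s` with each other are nonnegative, so that
subtracting `γ`, `δ` from `γ + δ + s` shows that `s` is a root of `𝔤₀`; as `γ + s` is a weight as
well, `γ` can be moved up by `s` in a single step. -/
lemma weightComponent_add_sum_eq_bot {i : LieSubalgebra ℂ L}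
    (hi : IsAbelianModuleSubalgebra 𝔤 b₀ i) (s : Multiset (Dual ℂ h₀))
    (hs : ∀ α ∈ s, α ∈ positiveRoots 𝔤 h₀ b₀) {γ δ : GradedWeight 𝔤 h₀} (hγ0 : γ.1 ≠ 0)
    (hδ0 : δ.1 ≠ 0) {x y : L} (hx : x ∈ weightComponent 𝔤 h₀ γ) (hx0 : x ≠ 0) (hxi : x ∈ i)
    (hy : y ∈ weightComponent 𝔤 h₀ δ) (hy0 : y ≠ 0) (hyi : y ∈ i) :
    weightComponent 𝔤 h₀ (γ + δ + (s.sum, 0)) = ⊥ := by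
  induction hcard : s.card using Nat.strong_induction_on generalizing s γ δ x y with
  | _ N ih =>
  subst hcard
  by_contra hlam
  have hxy := hi.lie_eq_zero hxi hyi
  have hγδ : 0 ≤ weightForm 𝔤 h₀ γ.1 δ.1 := by
    by_contra! h
    exact lie_ne_zero_of_weightForm_neg hγ0 hx hx0 hy hy0 h hxy
  have hγ : IsRealRoot 𝔤 h₀ γ := ⟨(Submodule.ne_bot_iff _).mpr ⟨x, hx, hx0⟩, hγ0⟩
  have hδ : IsRealRoot 𝔤 h₀ δ := ⟨(Submodule.ne_bot_iff _).mpr ⟨y, hy, hy0⟩, hδ0⟩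
  have hnonneg {ε : GradedWeight 𝔤 h₀} (hε0 : ε.1 ≠ 0) {z : L}
      (hz : z ∈ weightComponent 𝔤 h₀ ε) (hz0 : z ≠ 0) (hzi : z ∈ i)
      (hmove : ∀ α, ∀ t : Multiset (Dual ℂ h₀), s = α ::ₘ t → (ε + (α, 0)).1 ≠ 0 →
        ∀ w ∈ weightComponent 𝔤 h₀ (ε + (α, 0)), w ∈ i → w = 0) :
      0 ≤ weightForm 𝔤 h₀ ε.1 s.sum := by
    by_contra! h
    obtain ⟨α, hα, hneg⟩ := exists_mem_neg_of_sum_neg _ h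
    obtain ⟨t, ht⟩ := Multiset.exists_cons_of_mem hα
    have hαP := hs α hα
    obtain ⟨hα0, e, heb, he0, he⟩ := hs α hα
    have hmem := lie_mem_weightComponent he hz
    rw [add_comm] at hmem
    refine lie_ne_zero_of_weightForm_neg hα0 he (by simpa using he0) hz hz0
      (by rwa [weightForm_comm]) (hmove α t ht (fun h0 => hz0 ?_) _ hmem
        (hi.borel_stable e heb z hzi))
    have hαε : -ε.1 = α := neg_eq_of_add_eq_zero_right h0
    exact eq_zero_of_neg_mem_positiveRoots hi (hαε ▸ hαP) hzi hz
  have hγs : 0 ≤ weightForm 𝔤 h₀ γ.1 s.sum := by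
    refine hnonneg hγ0 hx hx0 hxi fun α t ht h0 w hw hwi => ?_
    by_contra hw0
    subst ht
    refine hlam ?_
    rw [← ih t.card (by simp) t (fun β hβ => hs β (by simp [hβ])) h0 hδ0 hw hw0 hwi hy hy0 hyi rfl]
    congr 1
    rw [Multiset.sum_cons]
    ext1
    · simp only [Prod.fst_add]
      abel
    · simp
  have hδs : 0 ≤ weightForm 𝔤 h₀ δ.1 s.sum := by
    refine hnonneg hδ0 hy hy0 hyi fun α t ht h0 w hw hwi => ?_
    by_contra hw0
    subst ht
    refine hlam ?_
    rw [← ih t.card (by simp) t (fun β hβ => hs β (by simp [hβ])) hγ0 h0 hx hx0 hxi hw hw0 hwi rfl]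
    congr 1
    rw [Multiset.sum_cons]
    ext1
    · simp only [Prod.fst_add]
      abel
    · simp
  have hγγ := weightForm_self_pos hγ
  have hδδ := weightForm_self_pos hδ
  have hγδ' := weightForm_comm (𝔤 := 𝔤) γ.1 δ.1
  have h1 : weightComponent 𝔤 h₀ (δ + (s.sum, 0)) ≠ ⊥ := by
    have := weightComponent_sub_ne_bot hγ hlam (by
      simp only [Prod.fst_add, map_add]
      linarith)
    rwa [add_assoc, add_sub_cancel_left] at this
  have h2 : weightComponent 𝔤 h₀ (γ + (s.sum, 0)) ≠ ⊥ := by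
    have := weightComponent_sub_ne_bot hδ hlam (by
      simp only [Prod.fst_add, map_add]
      linarith)
    rwa [add_comm γ δ, add_assoc, add_sub_cancel_left] at this
  have h3 : weightComponent 𝔤 h₀ (s.sum, 0) ≠ ⊥ := by
    have := weightComponent_sub_ne_bot hδ h1 (by
      simp only [Prod.fst_add, map_add]
      linarith)
    rwa [add_sub_cancel_left] at this
  by_cases hs0 : s.sum = 0
  · rw [hs0, Prod.mk_zero_zero, add_zero] at hlam
    exact lie_ne_zero_of_weightComponent_add_ne_bot hγ0 hδ0 hx hx0 hy hy0 hlam hxy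
  · obtain ⟨-, e, heb, he0, he⟩ := sum_mem_positiveRoots s hs hs0 h3
    have hex : ⁅(e : L), x⁆ ≠ 0 :=
      lie_ne_zero_of_weightComponent_add_ne_bot (p := (s.sum, 0)) hs0 hγ0 he (by simpa using he0)
        hx hx0 (by rwa [add_comm])
    have hmem := lie_mem_weightComponent he hx
    rw [add_comm] at hmem
    have hne : (γ + (s.sum, 0)).1 ≠ 0 := by
      intro h
      have h' : weightForm 𝔤 h₀ γ.1 (γ + (s.sum, 0)).1 = 0 := by rw [h, map_zero]
      simp only [Prod.fst_add, map_add] at h'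
      linarith
    have hcard : 0 < s.card := by
      rw [Multiset.card_pos]
      rintro rfl
      exact hs0 Multiset.sum_zero
    refine hlam ?_
    rw [← ih 0 hcard 0 (by simp) hne hδ0 hmem hex (hi.borel_stable e heb x hxi) hy hy0 hyi rfl]
    congr 1
    rw [Multiset.sum_zero, Prod.mk_zero_zero, add_zero, add_right_comm]

lemma lie_mem_upperSubmodule (hb₀ : LieAlgebra.IsSolvable b₀) (hle : h₀ ≤ b₀)
    {A : Set (GradedWeight 𝔤 h₀)} {b : degreeZero 𝔤} (hb : b ∈ b₀) {x : L}
    (hx : x ∈ upperSubmodule 𝔤 h₀ b₀ A) : ⁅(b : L), x⁆ ∈ upperSubmodule 𝔤 h₀ b₀ A := by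
  refine upperSubmodule_induction (C := fun x => ⁅(b : L), x⁆ ∈ upperSubmodule 𝔤 h₀ b₀ A)
    (fun q hq ⟨p, hp, hpq⟩ z hz => ?_) (by simp)
    (fun u v hu hv => by rw [lie_add]; exact Submodule.add_mem _ hu hv) hx
  refine Submodule.iSup_induction _
    (motive := fun c => ⁅c, z⁆ ∈ upperSubmodule 𝔤 h₀ b₀ A) (mem_iSup_of_mem_borel hle hb)
    (fun α c hc => ?_) (by simp)
    (fun u v hu hv => by rw [add_lie]; exact Submodule.add_mem _ hu hv)
  refine Submodule.iSup_induction _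
    (motive := fun c => ⁅c, z⁆ ∈ upperSubmodule 𝔤 h₀ b₀ A) hc
    (fun hα c hc => ?_) (by simp)
    (fun u v hu hv => by rw [add_lie]; exact Submodule.add_mem _ hu hv)
  have hαC : α ∈ positiveCone 𝔤 h₀ b₀ := by
    rcases hα with rfl | hα
    · exact AddSubmonoid.zero_mem _
    · exact positiveRoots_subset_positiveCone hb₀ hα
  refine mem_upperSubmodule (q := (α, 0) + q) (by simpa using hq) hp (hpq.trans ?_)
    (lie_mem_weightComponent hc hz)
  exact weightLE_iff_exists.mpr ⟨α, hαC, add_comm _ _⟩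

lemma lie_eq_zero_of_mem_upperSubmodule (hb₀ : LieAlgebra.IsSolvable b₀)
    {A : Set (GradedWeight 𝔤 h₀)}
    (hA : ∀ p₁ ∈ A, ∀ p₂ ∈ A, ∀ lam : Dual ℂ h₀, IsHighestWeight 𝔤 h₀ b₀ lam (p₁.2 + p₂.2) →
      ¬ WeightLE 𝔤 h₀ b₀ (p₁ + p₂) (lam, p₁.2 + p₂.2)) {x y : L}
    (hx : x ∈ upperSubmodule 𝔤 h₀ b₀ A) (hy : y ∈ upperSubmodule 𝔤 h₀ b₀ A) : ⁅x, y⁆ = 0 := by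
  refine upperSubmodule_induction (C := fun z : L => ⁅z, y⁆ = 0) (fun q hq ⟨p, hp, hpq⟩ x hx => ?_)
    (zero_lie y) (fun u v hu hv => by rw [add_lie, hu, hv, add_zero]) hx
  refine upperSubmodule_induction (C := fun z : L => ⁅x, z⁆ = 0)
    (fun q' hq' ⟨p', hp', hpq'⟩ y hy => ?_)
    (lie_zero x) (fun u v hu hv => by rw [lie_add, hu, hv, add_zero]) hy
  by_contra hxy
  have hadd := hpq.add hpq'
  have hne : weightComponent 𝔤 h₀ ((q + q').1, p.2 + p'.2) ≠ ⊥ := by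
    refine (Submodule.ne_bot_iff _).mpr ⟨_, ?_, hxy⟩
    have := lie_mem_weightComponent hx hy
    rwa [← Prod.mk.eta (p := q + q'), ← hadd.1] at this
  obtain ⟨lam, hlam, hle⟩ := exists_isHighestWeight hb₀ hne
  exact hA p hp p' hp' lam hlam ⟨rfl, (hadd.trans (r := (lam, (q + q').2)) ⟨rfl, hle⟩).2⟩

lemma mem_of_weightComponent_inf_upperSubmodule_ne_bot {A : Set (GradedWeight 𝔤 h₀)}
    {q : GradedWeight 𝔤 h₀} (hq : upperSubmodule 𝔤 h₀ b₀ A ⊓ weightComponent 𝔤 h₀ q ≠ ⊥) :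
    ∃ p ∈ A, WeightLE 𝔤 h₀ b₀ p q := by
  by_contra h
  refine hq (disjoint_iff.mp ((iSupIndep_weightComponent 𝔤 h₀ q).symm.mono_left ?_))
  refine iSup₂_le fun r hr => le_iSup₂_of_le r ?_ le_rfl
  rintro rfl
  exact h hr.2

/-- If no two elements of `A` have a sum below a highest weight, the weight spaces above `A` span
an abelian module subalgebra. -/
def upperSubalgebra (hb₀ : LieAlgebra.IsSolvable b₀) {A : Set (GradedWeight 𝔤 h₀)}
    (hA : ∀ p₁ ∈ A, ∀ p₂ ∈ A, ∀ lam : Dual ℂ h₀, IsHighestWeight 𝔤 h₀ b₀ lam (p₁.2 + p₂.2) →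
      ¬ WeightLE 𝔤 h₀ b₀ (p₁ + p₂) (lam, p₁.2 + p₂.2)) : LieSubalgebra ℂ L where
  __ := upperSubmodule 𝔤 h₀ b₀ A
  lie_mem' := fun {x y} hx hy => by
    rw [lie_eq_zero_of_mem_upperSubmodule hb₀ hA hx hy]
    exact Submodule.zero_mem _

lemma isAbelianModuleSubalgebra_upperSubalgebra (hb₀ : LieAlgebra.IsSolvable b₀) (hle : h₀ ≤ b₀)
    {A : Set (GradedWeight 𝔤 h₀)}
    (hA : ∀ p₁ ∈ A, ∀ p₂ ∈ A, ∀ lam : Dual ℂ h₀, IsHighestWeight 𝔤 h₀ b₀ lam (p₁.2 + p₂.2) →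
      ¬ WeightLE 𝔤 h₀ b₀ (p₁ + p₂) (lam, p₁.2 + p₂.2)) :
    IsAbelianModuleSubalgebra 𝔤 b₀ (upperSubalgebra hb₀ hA) where
  le_positivePart := iSup₂_le fun q hq => inf_le_left.trans (le_iSup₂_of_le q.2 hq.1 le_rfl)
  borel_stable := fun b hb x hx => lie_mem_upperSubmodule hb₀ hle hb hx
  nilpotent := by
    rw [eq_bot_iff, lowerCentralSeries_succ, LieSubmodule.lie_le_iff]
    rintro x - y -
    rw [LieSubmodule.mem_bot]
    exact Subtype.ext (lie_eq_zero_of_mem_upperSubmodule hb₀ hA x.2 y.2)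
  graded := by
    refine le_antisymm ?_ (iSup₂_le fun j _ => inf_le_left)
    exact iSup₂_le fun q hq => le_iSup₂_of_le q.2 hq.1
      (le_inf (le_iSup₂_of_le q hq le_rfl) inf_le_left)

end ModuleSubalgebras

end GradedBorel

end

theorem corollary2p3 {n : ℕ} [NeZero n]
    {L : Type*} [LieRing L] [LieAlgebra ℂ L] [FiniteDimensional ℂ L] [LieAlgebra.IsSimple ℂ L]
    (𝔤 : ZMod n → Submodule ℂ L) [GradedLieAlgebra 𝔤]
    (h₀ : LieSubalgebra ℂ (GradedBorel.degreeZero 𝔤)) (hh₀ : h₀.IsCartanSubalgebra)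
    (b₀ : LieSubalgebra ℂ (GradedBorel.degreeZero 𝔤)) (hb₀ : GradedBorel.IsBorel b₀)
    (hle : h₀ ≤ b₀)
    (A : Set (GradedBorel.GradedWeight 𝔤 h₀)) (hA : A ⊆ GradedBorel.sigmaPlus 𝔤 h₀)
    (hanti : IsAntichain (GradedBorel.WeightLE 𝔤 h₀ b₀) A) :
    GradedBorel.GeneratesAbelian 𝔤 h₀ b₀ A ↔
      ∀ p₁ ∈ A, ∀ p₂ ∈ A, ∀ lam : Module.Dual ℂ h₀,
        GradedBorel.IsHighestWeight 𝔤 h₀ b₀ lam (p₁.2 + p₂.2) →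
          ¬ GradedBorel.WeightLE 𝔤 h₀ b₀ (p₁ + p₂) (lam, p₁.2 + p₂.2) := by
  have hsolv : LieAlgebra.IsSolvable b₀ := hb₀.1
  constructor
  · rintro ⟨i, hi, rfl⟩ p₁ hp₁ p₂ hp₂ lam ⟨v, hv, hv0, -⟩ hlam
    obtain ⟨x, ⟨hxi, hx⟩, hx0⟩ := Submodule.exists_mem_ne_zero_of_ne_bot hp₁.1
    obtain ⟨y, ⟨hyi, hy⟩, hy0⟩ := Submodule.exists_mem_ne_zero_of_ne_bot hp₂.1
    obtain ⟨s, hs, hsum⟩ := AddSubmonoid.exists_multiset_of_mem_closure hlam.2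
    have hbot := GradedBorel.weightComponent_add_sum_eq_bot hi s (fun α hα => (hs α hα).1)
      (hA hp₁).2.1 (hA hp₂).2.1 hx hx0 hxi hy hy0 hyi
    have heq : p₁ + p₂ + (s.sum, 0) = (lam, p₁.2 + p₂.2) := by
      rw [hsum]
      exact Prod.ext (by simp) (by simp)
    rw [heq] at hbot
    rw [hbot, Submodule.mem_bot] at hv
    exact hv0 hv
  · intro hcond
    refine ⟨GradedBorel.upperSubalgebra hsolv hcond,
      GradedBorel.isAbelianModuleSubalgebra_upperSubalgebra hsolv hle hcond, ?_⟩
    ext p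
    constructor
    · intro hp
      refine ⟨?_, fun q hq hqp => ?_⟩
      · obtain ⟨x, hx, hx0⟩ := Submodule.exists_mem_ne_zero_of_ne_bot (hA hp).1
        exact (Submodule.ne_bot_iff _).mpr ⟨x, ⟨GradedBorel.mem_upperSubmodule (hA hp).2.2 hp
          (GradedBorel.weightLE_refl p) hx, hx⟩, hx0⟩
      · obtain ⟨p', hp', hp'q⟩ :=
          GradedBorel.mem_of_weightComponent_inf_upperSubmodule_ne_bot hq
        have hpp' : p' = p := hanti.eq hp' hp (hp'q.trans hqp)
        subst hpp'
        refine Prod.ext (sub_eq_zero.mp ?_) hqp.1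
        refine GradedBorel.eq_zero_of_mem_positiveCone hsolv hp'q.2 ?_
        rw [neg_sub]
        exact hqp.2
    · rintro ⟨hp, hmin⟩
      obtain ⟨p', hp', hp'p⟩ := GradedBorel.mem_of_weightComponent_inf_upperSubmodule_ne_bot hp
      obtain ⟨x, hx, hx0⟩ := Submodule.exists_mem_ne_zero_of_ne_bot (hA hp').1
      rw [← hmin p' ((Submodule.ne_bot_iff _).mpr ⟨x, ⟨GradedBorel.mem_upperSubmodule
        (hA hp').2.2 hp' (GradedBorel.weightLE_refl p') hx, hx⟩, hx0⟩) hp'p]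
      exact hp'
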